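/- Let $\mathbb{F}_q$ be a finite field with $q$ elements. By a curve over $\mathbb{F}_q$ we mean a one-dimensional, geometrically integral, separated scheme of finite type over $\mathbb{F}_q$ that is nonsingular (all its local rings are regular; equivalently, it is smooth over $\mathbb{F}_q$) and projective over $\mathbb{F}_q$. Let $f\colon X\to Y$ be a finite morphism of curves over $\mathbb{F}_q$ that is an exceptional cover, meaning that the diagonal is the only irreducible component of the $\mathbb{F}_q$-scheme $X\times_Y X$ that is geometrically irreducible over $\mathbb{F}_q$. Then, for every $\mathbb{F}_q$-rational point $x\in X(\mathbb{F}_q)$, the ramification index of $f$ at $x$ (the valuation at $x$ of the pullback of a uniformizer of $Y$ at $f(x)$) is coprime to $q-1$. -/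

import Mathlib

open CategoryTheory CategoryTheory.Limits AlgebraicGeometry

universe u

namespace CurveCover

noncomputable section

/-- The standard grading by degree of the polynomial ring `k[x₀, …, xₙ]`. -/
abbrev grading (k : Type u) [Field k] (n : ℕ) :
    ℕ → Submodule k (MvPolynomial (Fin (n + 1)) k) :=
  MvPolynomial.homogeneousSubmodule (Fin (n + 1)) k

instance (k : Type u) [Field k] (n : ℕ) : GradedAlgebra (grading k n) :=
  MvPolynomial.gradedAlgebra

/-- Projective space `ℙⁿ = Proj k[x₀, …, xₙ]` over a field `k`. -/
def projectiveSpace (k : Type u) [Field k] (n : ℕ) : Scheme.{u} :=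
  Proj (grading k n)

/-- The structure morphism `ℙⁿ ⟶ Spec k`: the canonical morphism to the spectrum of the
degree-zero part of `k[x₀, …, xₙ]`, followed by the morphism induced by `k → k[x₀, …, xₙ]₀`. -/
def projectiveSpaceToSpec (k : Type u) [Field k] (n : ℕ) :
    projectiveSpace k n ⟶ Spec (.of k) :=
  Proj.toSpecZero (grading k n) ≫ Spec.map (CommRingCat.ofHom (algebraMap k (grading k n 0)))

/-- A `k`-scheme is projective if it admits a closed immersion over `k` into some `ℙⁿ`. -/
def IsProjective {k : Type u} [Field k] {X : Scheme.{u}} (πX : X ⟶ Spec (.of k)) : Prop :=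
  ∃ (n : ℕ) (i : X ⟶ projectiveSpace k n),
    IsClosedImmersion i ∧ i ≫ projectiveSpaceToSpec k n = πX

/-- A nonsingular projective curve over `k`: a nonsingular projective one-dimensional geometrically
integral separated scheme of finite type over `k`. Nonsingular means that all local rings are
regular (over a perfect field this is the same as being smooth over `k`). -/
structure IsCurve {k : Type u} [Field k] {X : Scheme.{u}} (πX : X ⟶ Spec (.of k)) : Prop where
  isSeparated : IsSeparated πX
  locallyOfFiniteType : LocallyOfFiniteType πX
  quasiCompact : QuasiCompact πX
  geometricallyIntegral : GeometricallyIntegral πX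
  dimension : topologicalKrullDim X = 1
  nonsingular : ∀ x : X, IsRegularLocalRing (X.presheaf.stalk x)
  isProjective : IsProjective πX

/-- `Z` is an irreducible component of the `k`-scheme `W` which, with its reduced induced scheme
structure, is geometrically irreducible over `k`. -/
def IsGeometricallyIrreducibleComponent {k : Type u} [Field k] {W : Scheme.{u}}
    (πW : W ⟶ Spec (.of k)) (Z : Set W) : Prop :=
  ∃ hZ : Z ∈ irreducibleComponents W,
    GeometricallyIrreducible
      ((Scheme.IdealSheafData.vanishingIdeal
        (⟨Z, isClosed_of_mem_irreducibleComponents Z hZ⟩ :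
          TopologicalSpace.Closeds W)).subschemeι ≫ πW)

/-- A (finite) morphism `f : X ⟶ Y` of `k`-schemes is an exceptional cover if the diagonal is the only
irreducible component of the `k`-scheme `X ×[Y] X` that is geometrically irreducible over `k`. -/
def IsExceptionalCover {k : Type u} [Field k] {X Y : Scheme.{u}} (πX : X ⟶ Spec (.of k))
    (f : X ⟶ Y) : Prop :=
  {Z : Set ↥(pullback f f) |
    IsGeometricallyIrreducibleComponent (pullback.fst f f ≫ πX) Z} =
    {Set.range (pullback.diagonal f)}

/-- The ramification index of `f : X ⟶ Y` at `x`: the ramification index of the maximal ideal of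
`𝒪_{X,x}` over `𝒪_{Y,f(x)}`, i.e. the length of `𝒪_{X,x} / 𝔪_{f(x)} 𝒪_{X,x}`. For discrete
valuation rings, it is the valuation at `x` of a uniformizer at `f(x)`. -/
def ramificationIndex {X Y : Scheme.{u}} (f : X ⟶ Y) (x : X) : ℕ :=
  letI : Algebra (Y.presheaf.stalk (f x)) (X.presheaf.stalk x) := (f.stalkMap x).hom.toAlgebra
  (IsLocalRing.maximalIdeal (X.presheaf.stalk x)).ramificationIdx (Y.presheaf.stalk (f x))

end

end CurveCover

/-!
Suppose that a prime `l` divides both `q - 1` and the ramification index of `f` at the rational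
point `x`. The idea is to find a field `M ⊇ k` in which `k` is algebraically closed, with two
distinct embeddings of `k(X)` over `k(Y)`. They define a point of `X ×[Y] X`, outside the
diagonal, whose two projections are the generic point of `X`. Since `f` is finite, the closure of
this point is an irreducible component (`closure_singleton_mem_irreducibleComponents_of_isFinite`),
and since `M ⊗[k] K` is a domain for every field `K ⊇ k`
(`isDomain_tensorProduct_of_forall_isAlgebraic`), this component is geometrically irreducible
(`geometricallyIrreducible_subschemeι_comp`), against exceptionality.

The field `M` comes from Galois theory. Let `A` be the local ring of `Y` at `f x`, a discrete
valuation ring with uniformizer `π`, and let `C` be the finite normal `A`-algebra of functions on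
`X` near the fibre over `f x`, with `ε : C → k` the evaluation at `x`. As `l` divides the
ramification index, `π` can be chosen with `b π = a w ^ l` in `C` and `ε a = ε b ≠ 0`. Let `N` be a
finite normal extension of `K = Frac A` containing `C` and an `l`-th root `α` of `π`, and let `Q` be
a maximal ideal of the integral closure of `A` in `N` above `ker ε`. Consider the set `T` of all
`g ∈ Gal(N/K)` that fix `α` and induce `x ↦ x ^ q` modulo `Q`; it is a coset of the group `J` of
those that fix `α` and induce the identity modulo `Q`.

* The point `x` is rational, so the Frobenius of the residue field of `Q` lifts to an automorphism
  `τ` that fixes `C` (`exists_smul_sub_pow_mem`).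
* An automorphism that preserves `Q` and fixes `C` also fixes `α`, because
  `z = b α / w` satisfies `z ^ l = b ^ (l - 1) a`, so that its residue is a nonzero element of `k`
  (`apply_eq_self_of_smul_eq_self`).
* The extension `K(α)/K` is totally ramified, so some `σ` preserves `Q` without fixing `α`
  (`exists_gal_smul_eq_self_and_apply_ne`).

Thus `τ ∈ T` fixes the given embedding `φ` of `C`, and `σ τ σ⁻¹ ∈ T` fixes `σ φ`, which is not in
the `J`-orbit of `φ`. If every element of `T` fixed at most one conjugate of `φ`, then counting
would show that every element of `T` fixes a conjugate in the `J`-orbit of `φ`, a contradiction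
(`exists_two_fixed_points`). So some `g ∈ T` fixes two conjugates of `φ`. Let `M` be the fixed field
of `g`: an element of `M` algebraic over `k` agrees with its `q`-th power modulo `Q`, hence is
equal to it, and lies in `k`.
-/

namespace CurveCover

open TensorProduct Polynomial
open scoped Pointwise

/-! ### A counting argument -/

/-- Let `T` be a coset of a finite subgroup `J` that is normalised by `T`, and suppose that
elements of `T` fix two points of one `G`-orbit that are not in the same `J`-orbit. Then some element
of `T` fixes two distinct points of that orbit. -/
theorem exists_two_fixed_points {G Ω : Type*} [Group G] [MulAction G Ω]
    {J : Subgroup G} [Finite J] {T : Set G} (hTJ : ∀ t ∈ T, ∀ j ∈ J, t * j ∈ T)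
    (hJT : ∀ t ∈ T, ∀ j ∈ J, j * t ∈ T) (hT : ∀ t ∈ T, ∀ t' ∈ T, t⁻¹ * t' ∈ J)
    {ω₀ ω₁ : Ω} {t₀ t₁ : G} (h₀ : t₀ ∈ T) (h₁ : t₁ ∈ T) (hω₀ : t₀ • ω₀ = ω₀)
    (hω₁ : t₁ • ω₁ = ω₁) (hne : ω₁ ∉ MulAction.orbit J ω₀)
    (horb : ω₁ ∈ MulAction.orbit G ω₀) :
    ∃ t ∈ T, ∃ ω ∈ MulAction.orbit G ω₀, ∃ ω' ∈ MulAction.orbit G ω₀,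
      ω ≠ ω' ∧ t • ω = ω ∧ t • ω' = ω' := by
  by_contra! hcon
  have hcon' : ∀ t ∈ T, ∀ ω ∈ MulAction.orbit G ω₀, ∀ ω' ∈ MulAction.orbit G ω₀,
      t • ω = ω → t • ω' = ω' → ω = ω' := fun t ht ω hω ω' hω' h h' ↦ by
    by_contra hne
    exact hcon t ht ω hω ω' hω' hne h h'
  have hmem (ω : MulAction.orbit J ω₀) : (ω : Ω) ∈ MulAction.orbit G ω₀ :=
    MulAction.orbit_subgroup_subset J ω₀ ω.2
  choose s hs using fun ω : MulAction.orbit J ω₀ ↦ ω.2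
  have hs' (ω : MulAction.orbit J ω₀) : ((s ω : J) : G) • ω₀ = (ω : Ω) := hs ω
  have hfix (u : MulAction.stabilizer J ω₀) : ((u : J) : G) • ω₀ = ω₀ := u.2
  have hTf (p : MulAction.orbit J ω₀ × MulAction.stabilizer J ω₀) :
      ((s p.1 : J) : G) * t₀ * ((p.2 : J) : G) * ((s p.1 : J) : G)⁻¹ ∈ T :=
    hTJ _ (hTJ _ (hJT _ h₀ _ (s p.1).2) _ (p.2 : J).2) _ (inv_mem (s p.1).2)
  have hfp (p : MulAction.orbit J ω₀ × MulAction.stabilizer J ω₀) :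
      (((s p.1 : J) : G) * t₀ * ((p.2 : J) : G) * ((s p.1 : J) : G)⁻¹) • (p.1 : Ω) = p.1 := by
    have h : ((s p.1 : J) : G)⁻¹ • (p.1 : Ω) = ω₀ := inv_smul_eq_iff.mpr (hs' p.1).symm
    simp only [mul_smul, h, hfix, hω₀, hs']
  -- If no element of `T` fixes two points, then the elements of `T` fixing a point of `J ω₀`
  -- are as many as `(J ω₀) × (stabilizer of ω₀)`, that is, as many as `J`: they are all of `T`.
  let f : MulAction.orbit J ω₀ × MulAction.stabilizer J ω₀ → J := fun p ↦
    ⟨t₀⁻¹ * (((s p.1 : J) : G) * t₀ * ((p.2 : J) : G) * ((s p.1 : J) : G)⁻¹),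
      hT _ h₀ _ (hTf p)⟩
  have hf : Function.Injective f := by
    intro p p' hpp
    have h1 : ((s p.1 : J) : G) * t₀ * ((p.2 : J) : G) * ((s p.1 : J) : G)⁻¹ =
        ((s p'.1 : J) : G) * t₀ * ((p'.2 : J) : G) * ((s p'.1 : J) : G)⁻¹ :=
      mul_left_cancel (congrArg Subtype.val hpp)
    have h2 : p.1 = p'.1 :=
      Subtype.ext (hcon' _ (hTf p) _ (hmem _) _ (hmem _) (hfp p) (by rw [h1]; exact hfp p'))
    refine Prod.ext h2 (Subtype.ext (Subtype.ext ?_))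
    rw [h2] at h1
    exact mul_left_cancel (mul_right_cancel h1)
  let e := MulAction.orbitProdStabilizerEquivGroup J ω₀
  have hsurj : Function.Surjective (f ∘ e.symm) :=
    Finite.injective_iff_surjective.mp (hf.comp e.symm.injective)
  obtain ⟨j, hj⟩ := hsurj ⟨t₀⁻¹ * t₁, hT _ h₀ _ h₁⟩
  have h3 : _ = t₁ := mul_left_cancel (congrArg Subtype.val hj)
  have h4 := hfp (e.symm j)
  rw [h3] at h4
  exact hne (hcon' _ h₁ _ (hmem _) _ horb h4 hω₁ ▸ (e.symm j).1.2)

/-! ### Fields in which the ground field is algebraically closed -/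

/-- A form of the Nullstellensatz: over an algebraically closed field, a nonzero function on an
affine variety is nonzero at some point. -/
theorem exists_algHom_apply_ne_zero {k A : Type*} [Field k] [IsAlgClosed k] [CommRing A]
    [IsDomain A] [Algebra k A] [Algebra.FiniteType k A] {a : A} (ha : a ≠ 0) :
    ∃ χ : A →ₐ[k] k, χ a ≠ 0 := by
  let A' := Localization.Away a
  have : Nontrivial A' := (IsLocalization.injective A'
    (powers_le_nonZeroDivisors_of_noZeroDivisors ha)).nontrivial
  obtain ⟨I, hI⟩ := Ideal.exists_maximal A'
  let := Ideal.Quotient.field I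
  have : Algebra.FiniteType A A' := IsLocalization.finiteType_of_monoid_fg (.powers a) _
  have : Algebra.FiniteType k A' := .trans (S := A) inferInstance inferInstance
  have : Algebra.FiniteType k (A' ⧸ I) := inferInstance
  have : Module.Finite k (A' ⧸ I) := finite_of_finite_type_of_isJacobsonRing k _
  let ψ : (A' ⧸ I) →ₐ[k] k := IsAlgClosed.lift
  refine ⟨ψ.comp ((Ideal.Quotient.mkₐ k I).comp (IsScalarTower.toAlgHom k A A')), ?_⟩
  have h : IsUnit (algebraMap A A' a) := IsLocalization.Away.algebraMap_isUnit a
  exact ((h.map (Ideal.Quotient.mkₐ k I)).map ψ).ne_zero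

/-- The product of two zero divisors of `A ⊗[k] B` would stay zero after specialising `A` at a
`k`-point where a coefficient of each of them is nonzero, but `B` is a domain. -/
theorem isDomain_tensorProduct_of_isAlgClosed (k A B : Type*) [Field k] [IsAlgClosed k]
    [CommRing A] [IsDomain A] [Algebra k A] [CommRing B] [IsDomain B] [Algebra k B] :
    IsDomain (A ⊗[k] B) := by
  have hnt : Nontrivial (A ⊗[k] B) := inferInstance
  let b := Module.Basis.ofVectorSpace k B
  suffices NoZeroDivisors (A ⊗[k] B) from NoZeroDivisors.to_isDomain _
  refine ⟨fun {x y} hxy ↦ ?_⟩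
  by_contra! hne
  let bA := Algebra.TensorProduct.basis A b
  obtain ⟨i, hi⟩ : ∃ i, bA.repr x i ≠ 0 := by
    by_contra! h
    exact hne.1 (bA.repr.map_eq_zero_iff.mp (Finsupp.ext h))
  obtain ⟨j, hj⟩ : ∃ j, bA.repr y j ≠ 0 := by
    by_contra! h
    exact hne.2 (bA.repr.map_eq_zero_iff.mp (Finsupp.ext h))
  classical
  -- The coefficients of `x` and `y` generate a `k`-algebra of finite type, which has enough points.
  let S : Finset A := (bA.repr x).support.image (bA.repr x) ∪ (bA.repr y).support.image (bA.repr y)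
  let A₀ := Algebra.adjoin k (S : Set A)
  have hA₀ : Algebra.FiniteType k A₀ := A₀.fg_iff_finiteType.mp ⟨S, rfl⟩
  have hxm (l) : bA.repr x l ∈ A₀ := by
    by_cases h : bA.repr x l = 0
    · rw [h]; exact zero_mem _
    · exact Algebra.subset_adjoin (Finset.mem_coe.mpr (Finset.mem_union_left _
        (Finset.mem_image_of_mem _ (Finsupp.mem_support_iff.mpr h))))
  have hym (l) : bA.repr y l ∈ A₀ := by
    by_cases h : bA.repr y l = 0
    · rw [h]; exact zero_mem _
    · exact Algebra.subset_adjoin (Finset.mem_coe.mpr (Finset.mem_union_right _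
        (Finset.mem_image_of_mem _ (Finsupp.mem_support_iff.mpr h))))
  let x₀ : A₀ ⊗[k] B := ∑ l ∈ (bA.repr x).support, (⟨bA.repr x l, hxm l⟩ : A₀) ⊗ₜ[k] b l
  let y₀ : A₀ ⊗[k] B := ∑ l ∈ (bA.repr y).support, (⟨bA.repr y l, hym l⟩ : A₀) ⊗ₜ[k] b l
  let ι := Algebra.TensorProduct.map A₀.val (AlgHom.id k B)
  have hexp (z : A ⊗[k] B) : z = ∑ l ∈ (bA.repr z).support, bA.repr z l ⊗ₜ[k] b l := by
    conv_lhs => rw [← bA.linearCombination_repr z, Finsupp.linearCombination_apply, Finsupp.sum]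
    refine Finset.sum_congr rfl fun l _ ↦ ?_
    rw [Algebra.TensorProduct.basis_apply, TensorProduct.smul_tmul', smul_eq_mul, mul_one]
  have hιx : ι x₀ = x := by
    conv_rhs => rw [hexp x]
    simp [ι, x₀]
  have hιy : ι y₀ = y := by
    conv_rhs => rw [hexp y]
    simp [ι, y₀]
  have hinj : Function.Injective ι :=
    Module.Flat.rTensor_preserves_injective_linearMap (M := B) A₀.val.toLinearMap
      Subtype.val_injective
  have hxy₀ : x₀ * y₀ = 0 := hinj (by rw [map_mul, hιx, hιy, hxy, map_zero])
  obtain ⟨χ, hχ⟩ := exists_algHom_apply_ne_zero (k := k) (A := A₀)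
    (a := ⟨bA.repr x i, hxm i⟩ * ⟨bA.repr y j, hym j⟩)
    (mul_ne_zero (fun h ↦ hi (congrArg Subtype.val h)) (fun h ↦ hj (congrArg Subtype.val h)))
  rw [map_mul] at hχ
  let Ψ : A₀ ⊗[k] B →ₐ[k] B := (Algebra.TensorProduct.lid k B).toAlgHom.comp
    (Algebra.TensorProduct.map χ (AlgHom.id k B))
  have key (z : A ⊗[k] B) (hz : ∀ l, bA.repr z l ∈ A₀) (l : _) (hl : χ ⟨bA.repr z l, hz l⟩ ≠ 0) :
      Ψ (∑ l ∈ (bA.repr z).support, (⟨bA.repr z l, hz l⟩ : A₀) ⊗ₜ[k] b l) ≠ 0 := by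
    intro h0
    have h1 : ∑ l ∈ (bA.repr z).support, χ ⟨bA.repr z l, hz l⟩ • b l = 0 := by
      simpa [Ψ] using h0
    refine hl (linearIndependent_iff'.mp b.linearIndependent _ _ h1 l ?_)
    rw [Finsupp.mem_support_iff]
    rintro h
    refine hl ?_
    rw [show (⟨bA.repr z l, hz l⟩ : A₀) = 0 from Subtype.ext h, map_zero]
  refine mul_ne_zero (key x hxm i (left_ne_zero_of_mul hχ)) (key y hym j (right_ne_zero_of_mul hχ)) ?_
  rw [← map_mul]
  exact (congrArg Ψ hxy₀).trans (map_zero Ψ)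

/-- If `k` is algebraically closed in `L`, then minimal polynomials over `k` stay irreducible
over `L`: the coefficients of a factor are algebraic over `k`. -/
theorem natDegree_minpoly_eq_of_forall_isAlgebraic {k L E : Type*} [Field k] [Field L] [Field E]
    [Algebra k L] [Algebra L E] [Algebra k E] [IsScalarTower k L E]
    (h : ∀ x : L, IsAlgebraic k x → x ∈ Set.range (algebraMap k L)) {θ : E}
    (hθ : IsIntegral k θ) : (minpoly L θ).natDegree = (minpoly k θ).natDegree := by
  have hθL : IsIntegral L θ := hθ.tower_top
  have h1 := integralClosure.mem_lifts_of_monic_of_dvd_map L (minpoly.monic hθ)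
    (minpoly.monic hθL) (minpoly.dvd_map_of_isScalarTower k L θ)
  have h2 : minpoly L θ ∈ lifts (algebraMap k L) := by
    rw [lifts_iff_coeff_lifts] at h1 ⊢
    intro n
    obtain ⟨c, hc⟩ := h1 n
    rw [← hc]
    exact h _ (isAlgebraic_iff_isIntegral.mpr c.2)
  obtain ⟨p, hp, hdeg, hmon⟩ := lifts_and_natDegree_eq_and_monic h2 (minpoly.monic hθL)
  refine le_antisymm ?_ ?_
  · rw [← natDegree_map (algebraMap k L) (p := minpoly k θ)]
    exact natDegree_le_of_dvd (minpoly.dvd_map_of_isScalarTower k L θ)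
      ((minpoly.monic hθ).map _).ne_zero
  · rw [← hdeg]
    refine natDegree_le_of_dvd (minpoly.dvd k θ ?_) hmon.ne_zero
    rw [← aeval_map_algebraMap L, hp, minpoly.aeval]

/-- If `k` is perfect and algebraically closed in `L`, then `L` is linearly disjoint from every
algebraic extension of `k`, as each finite subextension is generated by one element. -/
theorem isDomain_tensorProduct_of_isAlgebraic (k L R : Type*) [Field k] [PerfectField k] [Field L]
    [Field R] [Algebra k L] [Algebra k R] [Algebra.IsAlgebraic k R]
    (h : ∀ x : L, IsAlgebraic k x → x ∈ Set.range (algebraMap k L)) :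
    IsDomain (L ⊗[k] R) := by
  let E := AlgebraicClosure L
  let fa : L →ₐ[k] E := IsScalarTower.toAlgHom k L E
  let fb : R →ₐ[k] E := IsAlgClosed.lift
  have hint : Algebra.IsIntegral k fb.range :=
    Algebra.IsIntegral.of_surjective fb.rangeRestrict fb.rangeRestrict_surjective
  suffices H : fa.range.LinearDisjoint fb.range from
    H.isDomain_of_injective fa.injective fb.injective
  refine Subalgebra.LinearDisjoint.of_linearDisjoint_finite_right _ _ fun B' _ _ ↦ ?_
  have hB' : IsField B' := isField_of_isIntegral_of_isField' (Field.toIsField k)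
  let M : IntermediateField k E := B'.toIntermediateField' hB'
  have : FiniteDimensional k M := ‹Module.Finite k B'›
  let pb : PowerBasis k M := Field.powerBasisOfFiniteOfSeparable k M
  let b : Module.Basis (Fin pb.dim) k B' := pb.basis
  refine Subalgebra.LinearDisjoint.of_basis_right _ _ b ?_
  have hθ : IsIntegral k (pb.gen : E) := (Algebra.IsIntegral.isIntegral pb.gen).map M.val
  have hdim : pb.dim = (minpoly L (pb.gen : E)).natDegree := by
    rw [natDegree_minpoly_eq_of_forall_isAlgebraic h hθ, ← pb.natDegree_minpoly,
      ← minpoly.algebraMap_eq (algebraMap M E).injective pb.gen]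
    rfl
  have hli := linearIndependent_pow (K := L) (pb.gen : E)
  rw [← hdim] at hli
  have heq : B'.val ∘ b = fun i : Fin pb.dim ↦ (pb.gen : E) ^ (i : ℕ) := by
    ext i
    change ((pb.basis i : M) : E) = _
    rw [pb.basis_eq_pow]
    rfl
  rw [heq]
  have hrange : ∀ c : fa.range, ∃ l : L, fa l = c := fun c ↦ c.2
  rw [linearIndependent_iff'] at hli ⊢
  intro s g hg i hi
  choose l hl using fun i ↦ hrange (g i)
  have := hli s l (by
    rw [← hg]
    refine Finset.sum_congr rfl fun i _ ↦ ?_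
    rw [Algebra.smul_def, Subalgebra.smul_def, ← hl]
    rfl) i hi
  refine Subtype.ext ?_
  rw [← hl, this, map_zero]
  rfl

/-- A field extension `L` of a perfect field `k` that contains no further algebraic elements is
geometrically integral over `k`. The general case follows from the case of an algebraic `K` and that
of an algebraically closed base, applied over the algebraic closure of `k`. -/
theorem isDomain_tensorProduct_of_forall_isAlgebraic {k L : Type*} [Field k] [PerfectField k]
    [Field L] [Algebra k L]
    (h : ∀ x : L, IsAlgebraic k x → x ∈ Set.range (algebraMap k L))
    (K : Type*) [Field K] [Algebra k K] :
    IsDomain (L ⊗[k] K) := by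
  let kb := AlgebraicClosure k
  let Kb := AlgebraicClosure K
  let : Algebra kb Kb := (IsAlgClosed.lift : kb →ₐ[k] Kb).toRingHom.toAlgebra
  have : IsScalarTower k kb Kb :=
    .of_algebraMap_eq fun x ↦ ((IsAlgClosed.lift : kb →ₐ[k] Kb).commutes x).symm
  have h1 : IsDomain (L ⊗[k] kb) := isDomain_tensorProduct_of_isAlgebraic k L kb h
  have h2 : IsDomain (kb ⊗[k] L) := (Algebra.TensorProduct.comm k kb L).toMulEquiv.isDomain
  have h3 : IsDomain (Kb ⊗[kb] (kb ⊗[k] L)) := isDomain_tensorProduct_of_isAlgClosed _ _ _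
  have h4 : IsDomain (Kb ⊗[k] L) :=
    (Algebra.TensorProduct.cancelBaseChange k kb Kb Kb L).symm.toMulEquiv.isDomain
  have h5 : IsDomain (L ⊗[k] Kb) := (Algebra.TensorProduct.comm k L Kb).toMulEquiv.isDomain
  let ι := Algebra.TensorProduct.map (AlgHom.id k L) (IsScalarTower.toAlgHom k K Kb)
  have hι : Function.Injective ι :=
    Module.Flat.lTensor_preserves_injective_linearMap (M := L)
      (IsScalarTower.toAlgHom k K Kb).toLinearMap (algebraMap K Kb).injective
  exact hι.isDomain ι.toRingHom

/-! ### Galois actions, Frobenius lifts and Eisenstein extensions -/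

/-- In a normal extension that need not be separable, the fixed field of `Gal(N/E)` is purely
inseparable over `E`. -/
theorem exists_pow_mem_of_forall_mem_fixingSubgroup {K N : Type*} [Field K] [Field N] [Algebra K N]
    [Normal K N] (p : ℕ) [ExpChar K p] (E : IntermediateField K N) {x : N}
    (h : ∀ g ∈ E.fixingSubgroup, g x = x) : ∃ n : ℕ, x ^ p ^ n ∈ E := by
  classical
  have : ExpChar E p := expChar_of_injective_algebraMap (algebraMap K E).injective p
  have : Normal E N := Normal.tower_top_of_normal K E N
  suffices hx : x ∈ perfectClosure E N by
    obtain ⟨n, y, hy⟩ := (mem_perfectClosure_iff_pow_mem p).mp hx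
    exact ⟨n, hy ▸ y.2⟩
  have hint : IsIntegral E x := Normal.isIntegral inferInstance x
  rw [mem_perfectClosure_iff_natSepDegree_eq_one,
    natSepDegree_eq_of_splits _ (Normal.splits inferInstance x), Finset.card_eq_one]
  refine ⟨x, Finset.eq_singleton_iff_unique_mem.mpr ⟨?_, fun y hy ↦ ?_⟩⟩
  · rw [Multiset.mem_toFinset, mem_aroots]
    exact ⟨minpoly.ne_zero hint, minpoly.aeval _ _⟩
  · rw [Multiset.mem_toFinset, mem_aroots] at hy
    obtain ⟨σ, rfl⟩ := minpoly.exists_algEquiv_of_root' hint.isAlgebraic hy.2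
    exact h (σ.restrictScalars K) fun e ↦ σ.commutes e

/-- The Frobenius of the residue field at `Q` lifts to the group `H` if the residue field of the
ring of `H`-invariants is `k`. -/
theorem exists_smul_sub_pow_mem {k S H : Type*} [Field k] [Finite k] [CommRing S] [Algebra k S]
    [Group H] [Finite H] [MulSemiringAction H S] (Q : Ideal S) [Q.IsMaximal]
    [Algebra.IsAlgebraic k (S ⧸ Q)]
    (hfix : ∀ r : S, (∀ h : H, h • r = r) → r ^ Nat.card k - r ∈ Q) :
    ∃ h : H, ∀ x : S, h • x - x ^ Nat.card k ∈ Q := by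
  have := Fintype.ofFinite k
  let R := FixedPoints.subring S H
  have hR : Algebra.IsInvariant R S H := ⟨fun b hb ↦ ⟨⟨b, hb⟩, rfl⟩⟩
  let P : Ideal R := Q.under R
  let := Ideal.Quotient.field Q
  let σ := FiniteField.frobeniusAlgEquivOfAlgebraic k (S ⧸ Q)
  have hσ (x : S ⧸ Q) : σ x = x ^ Nat.card k := by
    rw [Nat.card_eq_fintype_card]; rfl
  let τ : (S ⧸ Q) ≃ₐ[R ⧸ P] (S ⧸ Q) := AlgEquiv.ofRingEquiv (f := σ.toRingEquiv) (by
    intro r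
    obtain ⟨r, rfl⟩ := Ideal.Quotient.mk_surjective r
    change σ (Ideal.Quotient.mk Q (r : S)) = Ideal.Quotient.mk Q (r : S)
    rw [hσ, ← map_pow, Ideal.Quotient.eq]
    exact hfix _ fun h ↦ r.2 h)
  obtain ⟨g, hg⟩ := Ideal.Quotient.stabilizerHom_surjective H P Q τ
  refine ⟨g, fun x ↦ ?_⟩
  have h1 := congrArg (fun f ↦ f (Ideal.Quotient.mk Q x)) hg
  have h2 : τ (Ideal.Quotient.mk Q x) = Ideal.Quotient.mk Q (x ^ Nat.card k) := by
    rw [map_pow]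
    exact hσ _
  rw [← Ideal.Quotient.eq, ← h2, ← h1]
  rfl

section Eisenstein

variable {A K N : Type*} [CommRing A] [IsDomain A] [IsDiscreteValuationRing A] [Field K]
  [Algebra A K] [IsFractionRing A K] [Field N] [Algebra K N] [Algebra A N] [IsScalarTower A K N]

theorem isEisensteinAt_X_pow_sub_C {π : A} (hπ : Irreducible π) {l : ℕ} (hl : l ≠ 0) :
    (X ^ l - C π : A[X]).IsEisensteinAt (Ideal.span {π}) := by
  have hp : Prime π := hπ.prime
  refine (monic_X_pow_sub_C π hl).isEisensteinAt_of_mem_of_notMem ?_ (fun {n} hn ↦ ?_) ?_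
  · rw [Ne, Ideal.span_singleton_eq_top]
    exact hπ.not_isUnit
  · rw [natDegree_X_pow_sub_C] at hn
    rw [coeff_sub, coeff_X_pow, if_neg hn.ne, zero_sub, coeff_C]
    split_ifs
    · exact neg_mem (Ideal.mem_span_singleton_self π)
    · simp
  · rw [coeff_sub, coeff_X_pow, if_neg hl.symm, zero_sub, coeff_C_zero, neg_mem_iff,
      Ideal.span_singleton_pow, Ideal.mem_span_singleton]
    rintro ⟨c, hc⟩
    refine hπ.not_isUnit (IsUnit.of_mul_eq_one c ?_)
    refine mul_left_cancel₀ hπ.ne_zero ?_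
    rw [mul_one, ← mul_assoc, ← pow_two, ← hc]

theorem minpoly_eq_X_pow_sub_C [FaithfulSMul A N] {π : A} (hπ : Irreducible π) {l : ℕ}
    (hl : l ≠ 0) {α : N} (hα : α ^ l = algebraMap A N π) : minpoly A α = X ^ l - C π := by
  have hm := monic_X_pow_sub_C π hl
  have hirr : Irreducible (X ^ l - C π) :=
    (isEisensteinAt_X_pow_sub_C hπ hl).irreducible
      ((Ideal.span_singleton_prime hπ.ne_zero).mpr hπ.prime) hm.isPrimitive
      (by rw [natDegree_X_pow_sub_C]; exact Nat.pos_of_ne_zero hl)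
  have h0 : aeval α (X ^ l - C π) = 0 := by simp [hα]
  have hint : IsIntegral A α := ⟨_, hm, h0⟩
  have hd := minpoly.isIntegrallyClosed_dvd hint h0
  exact eq_of_monic_of_associated (minpoly.monic hint) hm
    (((minpoly.irreducible hint).associated_of_dvd hirr hd))

open IntermediateField in
/-- As `X ^ l - π` is Eisenstein, the integral elements of `K⟮α⟯` lie in `A[α]`, so they are
congruent modulo `α` to elements of `A`: the extension is totally ramified. -/
theorem exists_eq_add_mul_of_mem_adjoin {π : A} (hπ : Irreducible π) {l : ℕ} (hl : l ≠ 0) {α : N}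
    (hα : α ^ l = algebraMap A N π) {x : N} (hx : x ∈ K⟮α⟯) (hint : IsIntegral A x) :
    ∃ (c : A) (y : N), IsIntegral A y ∧ x = algebraMap A N c + α * y := by
  have hαi : IsIntegral A α :=
    ⟨X ^ l - C π, monic_X_pow_sub_C π hl, by simp [hα]⟩
  have hαK : IsIntegral K α := hαi.tower_top
  let B := adjoin.powerBasis hαK
  have : IsScalarTower A K⟮α⟯ N :=
    .of_algebraMap_eq fun a ↦ by
      rw [IsScalarTower.algebraMap_apply A K N, IsScalarTower.algebraMap_apply A K K⟮α⟯]
      rfl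
  have : FaithfulSMul A K⟮α⟯ := (faithfulSMul_iff_algebraMap_injective A K⟮α⟯).mpr (by
    rw [IsScalarTower.algebraMap_eq A K K⟮α⟯]
    exact (algebraMap K K⟮α⟯).injective.comp (IsFractionRing.injective A K))
  classical
  have hBint : IsIntegral A B.gen := by
    rw [← isIntegral_algebraMap_iff (algebraMap K⟮α⟯ N).injective]
    exact hαi
  let x' : K⟮α⟯ := ⟨x, hx⟩
  have hx'int : IsIntegral A x' := by
    rw [← isIntegral_algebraMap_iff (algebraMap K⟮α⟯ N).injective]
    exact hint
  -- The Eisenstein criterion for integral elements asks for a power of `π` as denominator.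
  obtain ⟨n, hn⟩ : ∃ n : ℕ, π ^ n • x' ∈ Algebra.adjoin A {B.gen} := by
    obtain ⟨b, hb⟩ := IsLocalization.exist_integer_multiples_of_finset (nonZeroDivisors A)
      (Finset.univ.image fun i ↦ B.basis.repr x' i)
    obtain ⟨n, u, hu⟩ := IsDiscreteValuationRing.eq_unit_mul_pow_irreducible
      (nonZeroDivisors.ne_zero b.2) hπ
    refine ⟨n, ?_⟩
    have h1 : π ^ n = (↑u⁻¹ : A) * b := by rw [hu, ← mul_assoc, Units.inv_mul, one_mul]
    rw [h1, mul_smul]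
    refine Subalgebra.smul_mem _ ?_ _
    rw [← B.basis.sum_repr x', Finset.smul_sum]
    refine Subalgebra.sum_mem _ fun i _ ↦ ?_
    obtain ⟨c, hc⟩ := hb _ (Finset.mem_image_of_mem _ (Finset.mem_univ i))
    rw [← smul_assoc, ← hc, algebraMap_smul, B.basis_eq_pow]
    exact Subalgebra.smul_mem _ (pow_mem (Algebra.self_mem_adjoin_singleton A _) _) _
  have hmin : minpoly A B.gen = X ^ l - C π := by
    refine minpoly_eq_X_pow_sub_C hπ hl (Subtype.ext ?_)
    exact hα
  have hadj := mem_adjoin_of_smul_prime_pow_smul_of_minpoly_isEisensteinAt (B := B) hπ.prime hBint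
    hx'int hn (hmin ▸ isEisensteinAt_X_pow_sub_C hπ hl)
  rw [Algebra.adjoin_singleton_eq_range_aeval] at hadj
  obtain ⟨P, hP⟩ := hadj
  have hP' : aeval α P = x := by
    have := congrArg (algebraMap K⟮α⟯ N) hP
    change algebraMap K⟮α⟯ N (aeval B.gen P) = x at this
    rwa [← aeval_algebraMap_apply] at this
  refine ⟨P.coeff 0, aeval α P.divX, ?_, ?_⟩
  · exact adjoin_le_integralClosure hαi (aeval_mem_adjoin_singleton A α)
  · rw [← hP']
    conv_lhs => rw [← P.divX_mul_X_add]
    rw [map_add, map_mul, aeval_X, aeval_C, mul_comm, add_comm]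

end Eisenstein

/-! ### Automorphisms fixing two embeddings -/

/-- The multiplicative group of a finite field is cyclic. -/
theorem exists_isPrimitiveRoot_of_dvd_card_sub_one {k : Type*} [Field k] [Finite k] {l : ℕ}
    (hdvd : l ∣ Nat.card k - 1) : ∃ ζ : k, IsPrimitiveRoot ζ l := by
  obtain ⟨g, hg⟩ := IsCyclic.exists_ofOrder_eq_natCard (α := kˣ)
  rw [Nat.card_units] at hg
  obtain ⟨m, hm⟩ := hdvd
  have hcard : 0 < Nat.card k - 1 := Nat.sub_pos_of_lt Finite.one_lt_card
  have h := (IsPrimitiveRoot.orderOf g).pow (n := orderOf g) (a := m) (b := l)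
    (hg ▸ hcard) (by rw [hg, hm, mul_comm])
  exact ⟨_, h.map_of_injective (f := Units.coeHom k) Units.val_injective⟩

theorem exists_algebraMap_of_pow_card_eq {k R : Type*} [Field k] [Finite k] [CommRing R] [IsDomain R]
    [Algebra k R] {x : R} (hx : x ^ Nat.card k = x) : ∃ c : k, algebraMap k R c = x := by
  have hcard : 0 < Nat.card k - 1 := Nat.sub_pos_of_lt Finite.one_lt_card
  have : NeZero (Nat.card k - 1) := ⟨hcard.ne'⟩
  by_cases h0 : x = 0
  · exact ⟨0, by rw [h0, map_zero]⟩
  · obtain ⟨ζ, hζ⟩ := exists_isPrimitiveRoot_of_dvd_card_sub_one (k := k) dvd_rfl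
    have h1 : x ^ (Nat.card k - 1) = 1 := by
      refine mul_right_cancel₀ h0 ?_
      rw [← pow_succ, Nat.sub_add_cancel Finite.one_lt_card.le, hx, one_mul]
    obtain ⟨i, -, hi⟩ :=
      (hζ.map_of_injective (algebraMap k R).injective).eq_pow_of_pow_eq_one h1
    exact ⟨ζ ^ i, by rw [map_pow, hi]⟩

theorem exists_algebraMap_mul_of_pow_eq_pow {k R : Type*} [Field k] [CommRing R] [IsDomain R]
    [Algebra k R] {l : ℕ} [NeZero l] {ζ : k} (hζ : IsPrimitiveRoot ζ l) {x y : R}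
    (h : x ^ l = y ^ l) : ∃ c : k, c ^ l = 1 ∧ x = algebraMap k R c * y := by
  have hl := Nat.pos_of_ne_zero (NeZero.ne l)
  have hζ' : IsPrimitiveRoot (algebraMap k R ζ) l := hζ.map_of_injective (algebraMap k R).injective
  have h1 := hζ'.pow_sub_pow_eq_prod_sub_mul x y hl
  rw [h, sub_self, eq_comm, Finset.prod_eq_zero_iff] at h1
  obtain ⟨r, hr, hr'⟩ := h1
  rw [mem_nthRootsFinset hl] at hr
  obtain ⟨i, -, rfl⟩ := hζ'.eq_pow_of_pow_eq_one hr
  refine ⟨ζ ^ i, by rw [← pow_mul, mul_comm, pow_mul, hζ.pow_eq_one, one_pow], ?_⟩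
  rw [map_pow]
  exact sub_eq_zero.mp hr'

theorem gal_apply_algebraMap_mul {k : Type*} (A : Type*) {K N : Type*} [CommRing k] [CommRing A]
    [Field K] [Field N] [Algebra k A] [Algebra A K] [Algebra K N] [Algebra A N] [Algebra k N]
    [IsScalarTower A K N] [IsScalarTower k A N] (g : Gal(N/K)) (c : k) (x : N) :
    g (algebraMap k N c * x) = algebraMap k N c * g x := by
  rw [map_mul, IsScalarTower.algebraMap_apply k A N, IsScalarTower.algebraMap_apply A K N,
    g.commutes]

/-- A finite group acts transitively on the primes above a given prime of the ring of
invariants. -/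
theorem exists_smul_eq_of_forall_mem_iff {G S : Type*} [Group G] [Finite G] [CommRing S]
    [MulSemiringAction G S] (P Q : Ideal S) [P.IsPrime] [Q.IsPrime]
    (h : ∀ r : S, (∀ g : G, g • r = r) → (r ∈ P ↔ r ∈ Q)) : ∃ g : G, Q = g • P := by
  let R := FixedPoints.subring S G
  have hR : Algebra.IsInvariant R S G := ⟨fun b hb ↦ ⟨⟨b, hb⟩, rfl⟩⟩
  refine Algebra.IsInvariant.exists_smul_of_under_eq R S G P Q ?_
  ext r
  exact h r r.2

instance smulCommClass_gal_of_isScalarTower {A K N : Type*} [CommRing A] [Field K] [Field N]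
    [Algebra A K] [Algebra K N] [Algebra A N] [IsScalarTower A K N] :
    SMulCommClass Gal(N/K) A N where
  smul_comm g a x := by
    rw [← algebraMap_smul K a x, smul_comm, algebraMap_smul]

theorem smul_eq_self_of_forall_smul_sub_pow_mem {G S : Type*} [Group G] [Finite G] [CommRing S]
    [MulSemiringAction G S] {Q : Ideal S} {q : ℕ} (hq : q ≠ 0) {g : G}
    (h : ∀ x : S, g • x - x ^ q ∈ Q) : g • Q = Q := by
  have hle : g • Q ≤ Q := by
    intro y hy
    rw [Ideal.mem_pointwise_smul_iff_inv_smul_mem] at hy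
    have := Q.add_mem (h (g⁻¹ • y)) (Ideal.pow_mem_of_mem Q hy q (Nat.pos_of_ne_zero hq))
    simpa using this
  exact smul_eq_of_smul_le hle

section Galois

variable {k A C K N : Type*} [Field k] [Finite k] [CommRing A] [IsDomain A]
  [IsDiscreteValuationRing A] [Algebra k A] [CommRing C] [Algebra k C] [Algebra A C]
  [IsScalarTower k A C] [Field K] [Algebra A K] [IsFractionRing A K] [Field N] [Algebra K N]
  [Algebra A N] [Algebra k N] [IsScalarTower A K N] [IsScalarTower k A N]
variable [FiniteDimensional K N] [Normal K N]

open IntermediateField in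
/-- Take `g` with `g α = ζ α` for a primitive `l`-th root of unity `ζ`. The ideals `Q` and `g Q`
have the same trace on `K⟮α⟯`, which is totally ramified, so some automorphism `h` over `K⟮α⟯` brings
`g Q` back to `Q`, and `h g` has the required property. -/
theorem exists_gal_smul_eq_self_and_apply_ne {π : A} (hπ : Irreducible π) {l : ℕ} (hl : l.Prime)
    (hdvd : l ∣ Nat.card k - 1) {α : N} (hα : α ^ l = algebraMap A N π)
    (Q : Ideal (integralClosure A N)) [Q.IsPrime]
    (hQ : algebraMap A (integralClosure A N) π ∈ Q) :
    ∃ h : Gal(N/K), h • Q = Q ∧ h α ≠ α := by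
  let p := ringExpChar K
  have hinjAN : Function.Injective (algebraMap A N) := by
    rw [IsScalarTower.algebraMap_eq A K N]
    exact (algebraMap K N).injective.comp (IsFractionRing.injective A K)
  have : FaithfulSMul A N := (faithfulSMul_iff_algebraMap_injective A N).mpr hinjAN
  have hα0 : α ≠ 0 := by
    rintro rfl
    rw [zero_pow hl.ne_zero, eq_comm, map_eq_zero_iff _ hinjAN] at hα
    exact hπ.ne_zero hα
  obtain ⟨ζ, hζ⟩ := exists_isPrimitiveRoot_of_dvd_card_sub_one (k := k) hdvd
  have hαi : _root_.IsIntegral A α :=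
    ⟨X ^ l - C π, monic_X_pow_sub_C π hl.ne_zero, by simp [hα]⟩
  obtain ⟨g, hg⟩ : ∃ g : Gal(N/K), g α = algebraMap k N ζ * α := by
    refine minpoly.exists_algEquiv_of_root' hαi.tower_top.isAlgebraic ?_
    rw [minpoly.isIntegrallyClosed_eq_field_fractions' K hαi, aeval_map_algebraMap,
      minpoly_eq_X_pow_sub_C hπ hl.ne_zero hα]
    simp only [map_sub, map_pow, aeval_X, aeval_C]
    rw [mul_pow, ← map_pow, hζ.pow_eq_one, map_one, one_mul, hα, sub_self]
  let H := K⟮α⟯.fixingSubgroup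
  have key (Q₁ Q₂ : Ideal (integralClosure A N)) [Q₁.IsPrime] [Q₂.IsPrime]
      (h₁ : algebraMap A (integralClosure A N) π ∈ Q₁)
      (h₂ : algebraMap A (integralClosure A N) π ∈ Q₂)
      (r : integralClosure A N) (hfix : ∀ h : H, h • r = r) (hr : r ∈ Q₁) : r ∈ Q₂ := by
    obtain ⟨n, hn⟩ := exists_pow_mem_of_forall_mem_fixingSubgroup p K⟮α⟯ (x := (r : N))
      fun h hh ↦ congrArg Subtype.val (hfix ⟨h, hh⟩)
    obtain ⟨c, y, hy, hxy⟩ := exists_eq_add_mul_of_mem_adjoin hπ hl.ne_zero hα hn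
      (r.2.pow _)
    let α' : integralClosure A N := ⟨α, hαi⟩
    let y' : integralClosure A N := ⟨y, hy⟩
    have hxy' : r ^ p ^ n = algebraMap A _ c + α' * y' := Subtype.ext hxy
    have hα' : α' ^ l = algebraMap A _ π := Subtype.ext hα
    have hα₁ : α' ∈ Q₁ := Ideal.IsPrime.mem_of_pow_mem ‹_› l (hα' ▸ h₁)
    have hα₂ : α' ∈ Q₂ := Ideal.IsPrime.mem_of_pow_mem ‹_› l (hα' ▸ h₂)
    have hc : algebraMap A (integralClosure A N) c ∈ Q₁ := by
      have := Q₁.sub_mem (Ideal.pow_mem_of_mem Q₁ hr (p ^ n)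
        (pow_pos (expChar_pos K p) n)) (Q₁.mul_mem_right y' hα₁)
      rwa [hxy', add_sub_cancel_right] at this
    have hcu : ¬ IsUnit c := fun hu ↦
      (inferInstance : Q₁.IsPrime).ne_top (Q₁.eq_top_of_isUnit_mem hc (hu.map _))
    have hπc : π ∣ c := by
      rw [← Ideal.mem_span_singleton, ← hπ.maximalIdeal_eq]
      exact hcu
    obtain ⟨d, rfl⟩ := hπc
    refine Ideal.IsPrime.mem_of_pow_mem ‹_› (p ^ n) ?_
    rw [hxy', map_mul]
    exact Q₂.add_mem (Q₂.mul_mem_right _ h₂) (Q₂.mul_mem_right _ hα₂)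
  have hgQ : algebraMap A (integralClosure A N) π ∈ g • Q := by
    rw [Ideal.mem_pointwise_smul_iff_inv_smul_mem, smul_algebraMap]
    exact hQ
  obtain ⟨h, hh⟩ := exists_smul_eq_of_forall_mem_iff (G := H) (g • Q) Q
    fun r hr ↦ ⟨key _ _ hgQ hQ r hr, key _ _ hQ hgQ r hr⟩
  refine ⟨(h : Gal(N/K)) * g, ?_, ?_⟩
  · rw [mul_smul]
    exact hh.symm
  · have h1 : (h : Gal(N/K)) α = α := h.2 ⟨α, mem_adjoin_simple_self K α⟩
    rw [AlgEquiv.mul_apply, hg, gal_apply_algebraMap_mul A, h1]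
    intro h2
    have h3 : algebraMap k N ζ = 1 := mul_right_cancel₀ hα0 (h2.trans (one_mul α).symm)
    rw [← map_one (algebraMap k N)] at h3
    exact hζ.ne_one hl.one_lt ((algebraMap k N).injective h3)

omit [FiniteDimensional K N] [Normal K N] [IsDomain A] [IsDiscreteValuationRing A]
  [IsScalarTower k A C] in
/-- An automorphism `g` that preserves `Q` and fixes `C` fixes the `l`-th root `α` of `π`, as the
residue of `b α / w` modulo `Q` is an `l`-th root of `ε b ^ l`, hence a nonzero element of `k`, and is
multiplied by the root of unity `g α / α`. -/
theorem apply_eq_self_of_smul_eq_self (ε : C →ₐ[k] k) (φ : C →ₐ[A] N) (hφ : Function.Injective φ)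
    (j : C →ₐ[A] integralClosure A N) (hj : ∀ c, (j c : N) = φ c)
    {π : A} (hπ : Irreducible π) {l : ℕ} (hl : l.Prime)
    (hdvd : l ∣ Nat.card k - 1) {α : N} (hα : α ^ l = algebraMap A N π)
    {a b w : C} (hε : ε a = ε b) (hb : ε b ≠ 0) (h : b * algebraMap A C π = a * w ^ l)
    (Q : Ideal (integralClosure A N)) [Q.IsPrime]
    (hQ : ∀ c, j c - algebraMap k (integralClosure A N) (ε c) ∈ Q)
    {g : Gal(N/K)} (hg : g • Q = Q) (hgφ : ∀ c, g (φ c) = φ c) : g α = α := by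
  have hinjAN : Function.Injective (algebraMap A N) := by
    rw [IsScalarTower.algebraMap_eq A K N]
    exact (algebraMap K N).injective.comp (IsFractionRing.injective A K)
  have : NeZero l := ⟨hl.ne_zero⟩
  have : Nontrivial (integralClosure A N ⧸ Q) :=
    Ideal.Quotient.nontrivial_iff.mpr (inferInstance : Q.IsPrime).ne_top
  obtain ⟨ζ, hζ⟩ := exists_isPrimitiveRoot_of_dvd_card_sub_one (k := k) hdvd
  have hφb : φ b ≠ 0 := by
    rw [Ne, map_eq_zero_iff _ hφ]
    rintro rfl
    exact hb (map_zero ε)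
  have hπN : algebraMap A N π ≠ 0 := by
    rw [Ne, map_eq_zero_iff _ hinjAN]
    exact hπ.ne_zero
  have hN : φ b * algebraMap A N π = φ a * φ w ^ l := by
    have := congrArg φ h
    rwa [map_mul, map_mul, map_pow, AlgHom.commutes] at this
  have hφw : φ w ≠ 0 := by
    intro h0
    rw [h0, zero_pow hl.ne_zero, mul_zero] at hN
    exact mul_ne_zero hφb hπN hN
  let z : N := φ b * α / φ w
  have hzl : z ^ l = φ b ^ (l - 1) * φ a := by
    rw [div_pow, mul_pow, hα, div_eq_iff (pow_ne_zero _ hφw), mul_assoc, ← hN, ← mul_assoc,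
      ← pow_succ, Nat.sub_add_cancel hl.one_lt.le]
  have hzi : _root_.IsIntegral A z := by
    refine IsIntegral.of_pow hl.pos ?_
    rw [hzl, ← hj, ← hj]
    exact ((j b).2.pow _).mul (j a).2
  let z' : integralClosure A N := ⟨z, hzi⟩
  have hz'l : z' ^ l = j b ^ (l - 1) * j a := Subtype.ext (by
    change z ^ l = (j b : N) ^ (l - 1) * (j a : N)
    rw [hj, hj, hzl])
  have hmk (c : C) : Ideal.Quotient.mk Q (j c) = algebraMap k _ (ε c) :=
    Ideal.Quotient.eq.mpr (hQ c)
  have hzQ : Ideal.Quotient.mk Q z' ^ l = algebraMap k (_ ⧸ Q) (ε b) ^ l := by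
    rw [← map_pow, hz'l, map_mul, map_pow, hmk, hmk, hε, ← pow_succ,
      Nat.sub_add_cancel hl.one_lt.le]
  obtain ⟨c, hc, hcz⟩ := exists_algebraMap_mul_of_pow_eq_pow hζ hzQ
  rw [← map_mul] at hcz
  have hd : c * ε b ≠ 0 := by
    refine mul_ne_zero ?_ hb
    rintro rfl
    rw [zero_pow hl.ne_zero] at hc
    exact zero_ne_one hc
  have hgα : (g α) ^ l = α ^ l := by
    rw [← map_pow, hα, IsScalarTower.algebraMap_apply A K N, g.commutes]
  obtain ⟨ξ, hξ, hgξ⟩ := exists_algebraMap_mul_of_pow_eq_pow hζ hgα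
  have hgz : g • z' = algebraMap k _ ξ * z' := Subtype.ext (by
    change g z = algebraMap k N ξ * z
    rw [map_div₀, map_mul, hgφ, hgφ, hgξ]
    ring)
  have h1 : g • (z' - algebraMap k _ (c * ε b)) ∈ Q := by
    rw [← hg, Ideal.smul_mem_pointwise_smul_iff]
    exact Ideal.Quotient.eq.mp hcz
  have hgk : g • algebraMap k (integralClosure A N) (c * ε b) = algebraMap k _ (c * ε b) :=
    Subtype.ext (by
      have := gal_apply_algebraMap_mul A g (c * ε b) 1
      rw [map_one, mul_one] at this
      exact this)
  rw [smul_sub, hgz, hgk, ← Ideal.Quotient.eq, map_mul, hcz] at h1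
  have h2 : algebraMap k (integralClosure A N ⧸ Q) (ξ * (c * ε b)) =
    algebraMap k (integralClosure A N ⧸ Q) (c * ε b) := by
      rw [map_mul]; exact h1
  have h3 : ξ = 1 := mul_right_cancel₀ hd
    (((algebraMap k (integralClosure A N ⧸ Q)).injective h2).trans (one_mul _).symm)
  rw [hgξ, h3, map_one, one_mul]

/-- Some automorphism `g` fixes two distinct conjugates `u φ` and `u' φ` of the embedding `φ`, and
its fixed field has no elements algebraic over `k` outside `k`. Here `E` is the fraction field of
`φ(C)` and `hE'` says that `C` is integrally closed. -/
theorem exists_gal_fixing_two_embeddings [Algebra.IsIntegral A C] (ε : C →ₐ[k] k) (φ : C →ₐ[A] N)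
    (hφ : Function.Injective φ) (E : IntermediateField K N) (hE : ∀ c, φ c ∈ E)
    (hE' : ∀ x ∈ E, _root_.IsIntegral A x → x ∈ Set.range φ)
    {π : A} (hπ : Irreducible π) {l : ℕ} (hl : l.Prime)
    (hdvd : l ∣ Nat.card k - 1) {α : N} (hα : α ^ l = algebraMap A N π)
    {a b w : C} (hε : ε a = ε b) (hb : ε b ≠ 0) (h : b * algebraMap A C π = a * w ^ l) :
    ∃ g u u' : Gal(N/K), (∀ c, g (u (φ c)) = u (φ c)) ∧ (∀ c, g (u' (φ c)) = u' (φ c)) ∧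
      (∃ c, u (φ c) ≠ u' (φ c)) ∧
      ∀ x : N, IsAlgebraic k x → g x = x → x ∈ Set.range (algebraMap k N) := by
  let S := integralClosure A N
  let q := Nat.card k
  have hq : q ≠ 0 := Nat.card_pos.ne'
  have hl0 : NeZero l := ⟨hl.ne_zero⟩
  obtain ⟨ζ, hζ⟩ := exists_isPrimitiveRoot_of_dvd_card_sub_one (k := k) hdvd
  let j : C →ₐ[A] S := φ.codRestrict S fun c ↦ (Algebra.IsIntegral.isIntegral c).map φ
  have hj (c : C) : (j c : N) = φ c := rfl
  obtain ⟨Q, hQmax, hQ⟩ : ∃ Q : Ideal S, Q.IsMaximal ∧ Q.comap j = RingHom.ker ε := by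
    let : Algebra C S := j.toRingHom.toAlgebra
    have : IsScalarTower A C S := .of_algebraMap_eq fun x ↦ (j.commutes x).symm
    have : Algebra.IsIntegral C S := Algebra.IsIntegral.tower_top A
    have : (RingHom.ker ε).IsMaximal := RingHom.ker_isMaximal_of_surjective ε fun x ↦
      ⟨algebraMap k C x, ε.commutes x⟩
    refine Ideal.exists_ideal_over_maximal_of_isIntegral (RingHom.ker ε) fun x hx ↦ ?_
    have hx' : φ x = 0 := congrArg Subtype.val (hx : j x = 0)
    rw [map_eq_zero_iff _ hφ] at hx'
    rw [hx']
    exact zero_mem _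
  have hQε (c : C) : j c - algebraMap k S (ε c) ∈ Q := by
    have h1 : c - algebraMap k C (ε c) ∈ Q.comap j := by
      rw [hQ, RingHom.mem_ker, map_sub, ε.commutes]
      exact sub_self _
    have h2 : j (algebraMap k C (ε c)) = algebraMap k S (ε c) := by
      rw [IsScalarTower.algebraMap_apply k A C, j.commutes]
      exact Subtype.ext (IsScalarTower.algebraMap_apply k A N _).symm
    rw [Ideal.mem_comap, map_sub, h2] at h1
    exact h1
  have hmk (c : C) : Ideal.Quotient.mk Q (j c) = algebraMap k (S ⧸ Q) (ε c) :=
    Ideal.Quotient.eq.mpr (hQε c)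
  have halg : Algebra.IsAlgebraic k (S ⧸ Q) := by
    refine ⟨fun x ↦ ?_⟩
    obtain ⟨s, rfl⟩ := Ideal.Quotient.mk_surjective x
    obtain ⟨P, hP, hPs⟩ := IsIntegralClosure.isIntegral A N s
    rw [isAlgebraic_iff_isIntegral]
    refine ⟨P.map (ε.toRingHom.comp (algebraMap A C)), hP.map _, ?_⟩
    have h1 : (algebraMap k (S ⧸ Q)).comp (ε.toRingHom.comp (algebraMap A C)) =
        (Ideal.Quotient.mk Q).comp (algebraMap A S) := by
      ext x
      exact (hmk (algebraMap A C x)).symm.trans (congrArg _ (j.commutes x))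
    rw [eval₂_map, h1, ← hom_eval₂, hPs, map_zero]
  let p := ringExpChar N
  have : ExpChar S p := RingHom.expChar (algebraMap S N) Subtype.val_injective p
  have : ExpChar K p := RingHom.expChar (algebraMap K N) (algebraMap K N).injective p
  obtain ⟨⟨τ, hτE⟩, hτ⟩ := exists_smul_sub_pow_mem (k := k) (H := E.fixingSubgroup) Q fun r hr ↦ by
    obtain ⟨n, hn⟩ := exists_pow_mem_of_forall_mem_fixingSubgroup (K := K) p E (x := (r : N))
      fun g hg ↦ congrArg Subtype.val (hr ⟨g, hg⟩)
    obtain ⟨c, hc⟩ := hE' _ hn (r.2.pow _)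
    have hc' : r ^ p ^ n = j c := Subtype.ext hc.symm
    refine Ideal.IsPrime.mem_of_pow_mem inferInstance (p ^ n) ?_
    rw [sub_pow_expChar_pow, ← pow_mul, mul_comm, pow_mul, hc', ← Ideal.Quotient.eq, map_pow, hmk,
      ← map_pow]
    have := Fintype.ofFinite k
    rw [Nat.card_eq_fintype_card, FiniteField.pow_card]
  replace hτ (x : S) : τ • x - x ^ q ∈ Q := hτ x
  have hτφ (c : C) : τ (φ c) = φ c := hτE ⟨φ c, hE c⟩
  have hfixα {g : Gal(N/K)} (hg : g • Q = Q) (hgφ : ∀ c, g (φ c) = φ c) : g α = α :=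
    apply_eq_self_of_smul_eq_self ε φ hφ j hj hπ hl hdvd hα hε hb h Q hQε hg hgφ
  have hτQ : τ • Q = Q := smul_eq_self_of_forall_smul_sub_pow_mem hq hτ
  have hτα : τ α = α := hfixα hτQ hτφ
  have hπQ : algebraMap A S π ∈ Q := by
    have h1 : ε (algebraMap A C π) = 0 := by
      let εA : A →+* k := ε.toRingHom.comp (algebraMap A C)
      have : (RingHom.ker εA).IsMaximal := RingHom.ker_isMaximal_of_surjective εA fun x ↦
        ⟨algebraMap k A x, by
          change ε (algebraMap A C (algebraMap k A x)) = x
          rw [← IsScalarTower.algebraMap_apply, ε.commutes]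
          rfl⟩
      have h2 : π ∈ RingHom.ker εA := by
        rw [IsLocalRing.eq_maximalIdeal this]
        exact hπ.not_isUnit
      exact h2
    have h2 := hQε (algebraMap A C π)
    rwa [h1, map_zero, sub_zero, j.commutes] at h2
  obtain ⟨σ, hσQ, hσα⟩ := exists_gal_smul_eq_self_and_apply_ne (k := k) (K := K) hπ hl hdvd hα Q hπQ
  -- `T` consists of the Frobenius lifts that fix `α`; it is a coset of `J`.
  let J : Subgroup Gal(N/K) := Q.inertia Gal(N/K) ⊓ MulAction.stabilizer Gal(N/K) α
  let T : Set Gal(N/K) := {g | g α = α ∧ ∀ x : S, g • x - x ^ q ∈ Q}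
  have hTQ {t : Gal(N/K)} (ht : t ∈ T) : t • Q = Q :=
    smul_eq_self_of_forall_smul_sub_pow_mem hq ht.2
  have hmem {g : Gal(N/K)} (hg : g • Q = Q) {x : S} (hx : x ∈ Q) : g • x ∈ Q := by
    rw [← hg]
    exact (Ideal.smul_mem_pointwise_smul_iff).mpr hx
  have hσinv : σ⁻¹ • Q = Q := by rw [inv_smul_eq_iff, hσQ]
  have hJ {g : Gal(N/K)} (hg : g ∈ J) : g α = α ∧ ∀ x : S, g • x - x ∈ Q :=
    ⟨hg.2, hg.1⟩
  -- The group `Gal(N/K)` acts on the embeddings of `C` through its action on `N`.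
  let ω₀ : C → N := φ
  obtain ⟨g, hgT, _, ⟨u, rfl⟩, _, ⟨u', rfl⟩, hne, hu, hu'⟩ :=
    exists_two_fixed_points (J := J) (T := T) (ω₀ := ω₀) (ω₁ := σ • ω₀) (t₀ := τ)
      (t₁ := σ * τ * σ⁻¹)
      (fun t ht g hg ↦ ⟨by rw [AlgEquiv.mul_apply, (hJ hg).1, ht.1], fun x ↦ by
        have := Q.add_mem (hmem (hTQ ht) ((hJ hg).2 x)) (ht.2 x)
        rwa [smul_sub, sub_add_sub_cancel, ← mul_smul] at this⟩)
      (fun t ht g hg ↦ ⟨by rw [AlgEquiv.mul_apply, ht.1, (hJ hg).1], fun x ↦ by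
        have := Q.add_mem ((hJ hg).2 (t • x)) (ht.2 x)
        rwa [sub_add_sub_cancel, ← mul_smul] at this⟩)
      (fun t ht t' ht' ↦ ⟨fun x ↦ by
        have h1 : t⁻¹ • Q = Q := by rw [inv_smul_eq_iff, hTQ ht]
        have := hmem h1 (Q.sub_mem (ht'.2 x) (ht.2 x))
        rwa [sub_sub_sub_cancel_right, smul_sub, inv_smul_smul, ← mul_smul] at this, by
        change t⁻¹ (t' α) = α
        rw [ht'.1]
        exact inv_smul_eq_iff.mpr (show α = t • α from ht.1.symm)⟩)
      ⟨hτα, hτ⟩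
      -- `σ τ σ⁻¹` lies in `T`: it fixes `α` as `σ⁻¹ α / α` is a root of unity in `k`.
      ⟨by
        obtain ⟨ξ, -, hξ⟩ := exists_algebraMap_mul_of_pow_eq_pow (x := σ⁻¹ α) (y := α) hζ (by
          rw [← map_pow, hα, IsScalarTower.algebraMap_apply A K N]
          exact AlgEquiv.commutes _ _)
        rw [AlgEquiv.mul_apply, AlgEquiv.mul_apply, hξ, gal_apply_algebraMap_mul A, hτα, ← hξ]
        exact smul_inv_smul σ α, fun x ↦ by
        have := hmem hσQ (hτ (σ⁻¹ • x))
        rwa [smul_sub, smul_pow', smul_inv_smul, ← mul_smul, ← mul_smul] at this⟩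
      (funext hτφ)
      (by
        rw [mul_smul, mul_smul, inv_smul_smul]
        congr 1
        exact funext hτφ)
      (by
        -- If `g ∈ J` agrees with `σ` on `φ(C)`, then `g⁻¹ σ` fixes `C` and preserves `Q`, so it
        -- fixes `α`, and `σ α = g α = α`.
        rintro ⟨⟨g, hg⟩, hgσ⟩
        replace hgσ : g • ω₀ = σ • ω₀ := hgσ
        have hgQ : g • Q = Q := by
          refine smul_eq_of_smul_le fun y hy ↦ ?_
          rw [Ideal.mem_pointwise_smul_iff_inv_smul_mem] at hy
          have := Q.add_mem ((hJ hg).2 (g⁻¹ • y)) hy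
          rwa [sub_add_cancel, smul_inv_smul] at this
        have h1 : (g⁻¹ * σ) α = α := hfixα
          (by rw [mul_smul, hσQ, inv_smul_eq_iff, hgQ]) fun c ↦ by
            have := congrFun (inv_smul_eq_iff.mpr hgσ.symm) c
            rw [← mul_smul] at this
            exact this
        refine hσα ?_
        have h2 : σ • α = g • α := inv_smul_eq_iff.mp (show g⁻¹ • (σ • α) = α from h1)
        change σ α = g α at h2
        rw [h2, (hJ hg).1])
      ⟨σ, rfl⟩
  refine ⟨g, u, u', congrFun hu, congrFun hu', Function.ne_iff.mp hne, fun x hx hgx ↦ ?_⟩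
  have hxA : _root_.IsIntegral A x := hx.isIntegral.tower_top
  let x' : S := ⟨x, hxA⟩
  have hxQ : x' - x' ^ q ∈ Q := by
    have h1 : g • x' = x' := Subtype.ext hgx
    have h2 := hgT.2 x'
    rwa [h1] at h2
  -- The element `x - x ^ q` lies in `Q`, but nonzero elements algebraic over `k` are units.
  have hx0 : x - x ^ q = 0 := by
    by_contra hne0
    have halg' : IsAlgebraic k (x - x ^ q)⁻¹ := (hx.sub (hx.pow q)).inv
    let y : S := ⟨(x - x ^ q)⁻¹, halg'.isIntegral.tower_top⟩
    have hy : (x' - x' ^ q) * y = 1 := Subtype.ext (mul_inv_cancel₀ hne0)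
    exact hQmax.ne_top ((Ideal.eq_top_iff_one Q).mpr (hy ▸ Q.mul_mem_right y hxQ))
  obtain ⟨c, hc⟩ := exists_algebraMap_of_pow_card_eq (sub_eq_zero.mp hx0).symm
  exact ⟨c, hc⟩

end Galois

/-! ### A field with two embeddings -/

/-- The extension `M` is the fixed field of an automorphism as in
`exists_gal_fixing_two_embeddings`, inside a finite normal extension of `Frac A` that contains `C`
and an `l`-th root of `π`. -/
theorem exists_two_ringHoms {k A C : Type u} [Field k] [Finite k] [CommRing A] [IsDomain A]
    [IsDiscreteValuationRing A] [Algebra k A] [CommRing C] [IsDomain C] [IsIntegrallyClosed C]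
    [Algebra k C] [Algebra A C] [IsScalarTower k A C] [Module.Finite A C] [FaithfulSMul A C]
    (ε : C →ₐ[k] k) {π : A} (hπ : Irreducible π) {l : ℕ} (hl : l.Prime)
    (hdvd : l ∣ Nat.card k - 1) {a b w : C} (hε : ε a = ε b) (hb : ε b ≠ 0)
    (h : b * algebraMap A C π = a * w ^ l) :
    ∃ (M : Type u) (_ : Field M) (_ : Algebra k M) (φ₁ φ₂ : C →+* M),
      φ₁.comp (algebraMap A C) = φ₂.comp (algebraMap A C) ∧
      φ₁.comp (algebraMap k C) = algebraMap k M ∧ Function.Injective φ₁ ∧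
      Function.Injective φ₂ ∧ φ₁ ≠ φ₂ ∧
      ∀ x : M, IsAlgebraic k x → x ∈ Set.range (algebraMap k M) := by
  let K := FractionRing A
  let L := AlgebraicClosure K
  have : FaithfulSMul A L := by
    rw [faithfulSMul_iff_algebraMap_injective, IsScalarTower.algebraMap_eq A K L]
    exact (algebraMap K L).injective.comp (IsFractionRing.injective A K)
  have hCalg : Algebra.IsAlgebraic A C := Algebra.IsIntegral.isAlgebraic
  let φL : C →ₐ[A] L := IsAlgClosed.lift
  have hφL : Function.Injective φL := by
    let : Algebra C L := φL.toRingHom.toAlgebra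
    have : IsScalarTower A C L := .of_algebraMap_eq fun x ↦ (φL.commutes x).symm
    exact Algebra.IsAlgebraic.injective_tower_top (R := A) C
      (FaithfulSMul.algebraMap_injective A L)
  obtain ⟨α, hα⟩ := IsAlgClosed.exists_pow_nat_eq (algebraMap A L π) hl.pos
  obtain ⟨s, hs⟩ := (inferInstance : Module.Finite A C).fg_top
  let E₀ : IntermediateField K L := IntermediateField.adjoin K (insert α (φL '' (s : Set C)))
  have hfinset : Finite ↥(insert α (φL '' (s : Set C))) :=
    (s.finite_toSet.image _ |>.insert α)
  have : FiniteDimensional K E₀ := IntermediateField.finiteDimensional_adjoin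
    fun x _ ↦ Algebra.IsIntegral.isIntegral x
  let N := IntermediateField.normalClosure K E₀ L
  have hE₀N : E₀ ≤ N := IntermediateField.le_normalClosure E₀
  have hαN : α ∈ N := hE₀N (IntermediateField.subset_adjoin K _ (Set.mem_insert _ _))
  have hφN (c : C) : φL c ∈ N := by
    have hc : c ∈ Submodule.span A (s : Set C) := hs ▸ Submodule.mem_top
    induction hc using Submodule.span_induction with
    | mem x hx =>
      exact hE₀N (IntermediateField.subset_adjoin K _ (Set.mem_insert_of_mem _ ⟨x, hx, rfl⟩))
    | zero => rw [map_zero]; exact zero_mem N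
    | add x y _ _ hx hy => rw [map_add]; exact add_mem hx hy
    | smul r x _ hx =>
      rw [map_smul, ← algebraMap_smul K r (φL x)]
      exact N.smul_mem hx
  let φ : C →ₐ[A] N := φL.codRestrict (N.toSubalgebra.restrictScalars A) hφN
  have hφ : Function.Injective φ := fun x y hxy ↦ hφL (congrArg Subtype.val hxy)
  let ψ : FractionRing C →ₐ[A] N := IsFractionRing.liftAlgHom (g := φ) hφ
  have hψ (c : C) : ψ (algebraMap C _ c) = φ c := IsFractionRing.lift_algebraMap hφ c
  let E : IntermediateField K N := ψ.toRingHom.fieldRange.toIntermediateField fun x ↦ by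
    obtain ⟨r, s, -, rfl⟩ := IsFractionRing.div_surjective (A := A) x
    rw [map_div₀, ← IsScalarTower.algebraMap_apply A K N, ← IsScalarTower.algebraMap_apply A K N]
    exact div_mem ⟨algebraMap A _ r, ψ.commutes r⟩ ⟨algebraMap A _ s, ψ.commutes s⟩
  have : IsScalarTower k A N :=
    .of_algebraMap_eq fun x ↦ Subtype.ext (IsScalarTower.algebraMap_apply k A L x)
  obtain ⟨g, u, u', hu, hu', ⟨c₀, hc₀⟩, hg⟩ :=
    exists_gal_fixing_two_embeddings (K := K) (N := N) ε φ hφ E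
      (fun c ↦ ⟨algebraMap C _ c, hψ c⟩)
      (by
        rintro _ ⟨x, rfl⟩ hx
        have hx' : _root_.IsIntegral A x := (isIntegral_algHom_iff ψ ψ.toRingHom.injective).mp hx
        obtain ⟨c, rfl⟩ := IsIntegrallyClosed.isIntegral_iff.mp (hx'.tower_top (A := C))
        exact ⟨c, (hψ c).symm⟩)
      hπ hl hdvd (α := ⟨α, hαN⟩) (Subtype.ext hα) hε hb h
  let M := IntermediateField.fixedField (Subgroup.zpowers g)
  have hM (x : N) (hx : g x = x) : x ∈ M := by
    rw [IntermediateField.mem_fixedField_iff]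
    intro f hf
    have h1 : g ∈ MulAction.stabilizer Gal(N/K) x := hx
    exact (Subgroup.zpowers_le.mpr h1) hf
  have hMg (x : M) : g x = x :=
    IntermediateField.mem_fixedField_iff _ _ |>.mp x.2 g (Subgroup.mem_zpowers g)
  let Φ (v : Gal(N/K)) (hv : ∀ c, g (v (φ c)) = v (φ c)) : C →+* M :=
    (v.toAlgHom.toRingHom.comp φ.toRingHom).codRestrict M.toSubring fun c ↦ hM _ (hv c)
  have hΦ (v : Gal(N/K)) (hv) (x : A) : Φ v hv (algebraMap A C x) = algebraMap A M x := by
    refine Subtype.ext ?_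
    change v (φ (algebraMap A C x)) = algebraMap A N x
    rw [φ.commutes, IsScalarTower.algebraMap_apply A K N, v.commutes]
  have hinj (v : Gal(N/K)) (hv) : Function.Injective (Φ v hv) := fun x y hxy ↦
    hφ (v.injective (congrArg Subtype.val hxy))
  refine ⟨M, inferInstance, inferInstance, Φ u hu, Φ u' hu', ?_, ?_, hinj u hu, hinj u' hu', ?_, ?_⟩
  · refine RingHom.ext fun x ↦ ?_
    exact (hΦ u hu x).trans (hΦ u' hu' x).symm
  · refine RingHom.ext fun x ↦ ?_
    rw [RingHom.comp_apply, IsScalarTower.algebraMap_apply k A C, hΦ u hu]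
    exact Subtype.ext (IsScalarTower.algebraMap_apply k A N x).symm
  · intro h'
    exact hc₀ (congrArg Subtype.val (RingHom.congr_fun h' c₀))
  · intro x hx
    obtain ⟨c, hc⟩ := hg x ((isAlgebraic_algHom_iff (M.val.restrictScalars k)
      Subtype.val_injective).mpr hx) (hMg x)
    exact ⟨c, Subtype.ext hc⟩

/-! ### From ramification to the two embeddings -/

open IsLocalRing in
/-- For discrete valuation rings, `Ideal.ramificationIdx` is the valuation of a uniformizer. -/
theorem associated_algebraMap_pow_ramificationIdx {A B : Type*} [CommRing A] [IsDomain A]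
    [IsDiscreteValuationRing A] [CommRing B] [IsDomain B] [IsDiscreteValuationRing B] [Algebra A B]
    [FaithfulSMul A B] [IsLocalHom (algebraMap A B)] {π : A} {t : B} (hπ : Irreducible π)
    (ht : Irreducible t) :
    Associated (algebraMap A B π) (t ^ (maximalIdeal B).ramificationIdx A) := by
  have hπ0 : algebraMap A B π ≠ 0 := by
    rw [Ne, map_eq_zero_iff _ (FaithfulSMul.algebraMap_injective A B)]
    exact hπ.ne_zero
  obtain ⟨n, hn⟩ := IsDiscreteValuationRing.associated_pow_irreducible hπ0 ht
  have h1 : (maximalIdeal A).map (algebraMap A B) = maximalIdeal B ^ n := by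
    rw [hπ.maximalIdeal_eq, Ideal.map_span, Set.image_singleton, ht.maximalIdeal_eq,
      Ideal.span_singleton_pow]
    exact Ideal.span_singleton_eq_span_singleton.mpr hn
  have h0 : maximalIdeal B ≠ ⊥ := IsDiscreteValuationRing.not_a_field B
  have h4 : (maximalIdeal B).comap (algebraMap A B) = maximalIdeal A :=
    ((local_hom_TFAE (algebraMap A B)).out 0 4).mp ‹IsLocalHom (algebraMap A B)›
  have : (maximalIdeal B).LiesOver (maximalIdeal A) :=
    ⟨h4.symm⟩
  rwa [Ideal.IsDedekindDomain.ramificationIdx_eq_multiplicity (maximalIdeal A) (maximalIdeal B)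
    (h1 ▸ pow_ne_zero n h0), h1, multiplicity_pow_self h0 (mt Ideal.isUnit_iff.mp Ideal.IsPrime.ne_top')]

/-- A morphism of integral affine schemes that is integral is dominant if it sends a non-generic
point to a point of codimension one: the kernel is strictly smaller than `m` by incomparability. -/
theorem faithfulSMul_of_isDiscreteValuationRing_atPrime {R S : Type*} [CommRing R] [IsDomain R]
    [CommRing S] [IsDomain S] [Algebra R S] [Algebra.IsIntegral R S] {p : Ideal S} (hp : p ≠ ⊥)
    (m : Ideal R) [m.IsPrime] (hm : m = p.comap (algebraMap R S)) (A : Type*) [CommRing A]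
    [IsDomain A] [IsDiscreteValuationRing A] [Algebra R A] [IsLocalization.AtPrime A m] :
    FaithfulSMul R S := by
  rw [faithfulSMul_iff_algebraMap_injective, RingHom.injective_iff_ker_eq_bot]
  have hinj : Function.Injective (algebraMap R A) :=
    IsLocalization.injective A m.primeCompl_le_nonZeroDivisors
  let q : Ideal R := RingHom.ker (algebraMap R S)
  have hq : q.IsPrime := RingHom.ker_isPrime _
  have hlt : q < m := by
    rw [hm]
    exact Ideal.IsIntegral.comap_lt_comap (I := (⊥ : Ideal S)) (bot_lt_iff_ne_bot.mpr hp)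
  have hd : Disjoint (m.primeCompl : Set R) q :=
    Set.disjoint_left.mpr fun x hx hxq ↦ hx (hlt.le hxq)
  have hprime : (q.map (algebraMap R A)).IsPrime :=
    IsLocalization.isPrime_of_isPrime_disjoint m.primeCompl A q hq hd
  have hunder := IsLocalization.under_map_of_isPrime_disjoint m.primeCompl A hq hd
  by_cases h0 : q.map (algebraMap R A) = ⊥
  · rw [h0] at hunder
    rw [show RingHom.ker (algebraMap R S) = q from rfl, ← hunder]
    exact (RingHom.injective_iff_ker_eq_bot _).mp hinj
  · have hmax := IsLocalRing.eq_maximalIdeal (hprime.isMaximal h0)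
    rw [hmax] at hunder
    exact absurd (hunder.symm.trans (IsLocalization.AtPrime.under_maximalIdeal A m)) hlt.ne

/-- The statement of `exists_two_ringHoms` for a finite extension `S` of a ring `R` whose
localization at the prime `m` below `ker ε` is a discrete valuation ring. -/
theorem exists_two_ringHoms_of_isLocalization {k R S : Type u} [Field k] [Finite k] [CommRing R]
    [IsDomain R] [CommRing S] [IsDomain S] [IsIntegrallyClosed S] [Algebra k R] [Algebra k S]
    [Algebra R S] [IsScalarTower k R S] [Module.Finite R S] [FaithfulSMul R S]
    (ε : S →ₐ[k] k) (m : Ideal R) [m.IsPrime] (hm : m = (RingHom.ker ε).comap (algebraMap R S))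
    {A : Type u} [CommRing A] [IsDomain A] [IsDiscreteValuationRing A] [Algebra R A]
    [IsLocalization.AtPrime A m]
    {π : R} (hπ : Irreducible (algebraMap R A π)) {l : ℕ} (hl : l.Prime)
    (hdvd : l ∣ Nat.card k - 1) {a b w : S} (hε : ε a = ε b) (hb : ε b ≠ 0)
    (h : b * algebraMap R S π = a * w ^ l) :
    ∃ (M : Type u) (_ : Field M) (_ : Algebra k M) (φ₁ φ₂ : S →+* M),
      φ₁.comp (algebraMap R S) = φ₂.comp (algebraMap R S) ∧
      φ₁.comp (algebraMap k S) = algebraMap k M ∧ Function.Injective φ₁ ∧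
      Function.Injective φ₂ ∧ φ₁ ≠ φ₂ ∧
      ∀ x : M, IsAlgebraic k x → x ∈ Set.range (algebraMap k M) := by
  let T := Algebra.algebraMapSubmonoid S m.primeCompl
  let C := Localization T
  have hT : T ≤ nonZeroDivisors S := algebraMapSubmonoid_le_nonZeroDivisors_of_faithfulSMul S
    m.primeCompl_le_nonZeroDivisors
  have hSC : Function.Injective (algebraMap S C) := IsLocalization.injective C hT
  have : IsDomain C := IsLocalization.isDomain_localization hT
  have : IsIntegrallyClosed C := isIntegrallyClosed_of_isLocalization C T hT
  let : Algebra k A := ((algebraMap R A).comp (algebraMap k R)).toAlgebra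
  have : IsScalarTower k R A := .of_algebraMap_eq fun _ ↦ rfl
  let : Algebra A C := localizationAlgebra m.primeCompl S
  have : IsScalarTower R A C := isScalarTower_localizationAlgebra _ _
  have : IsScalarTower k A C := .of_algebraMap_eq fun c ↦ by
    rw [IsScalarTower.algebraMap_apply k R A, ← IsScalarTower.algebraMap_apply R A C,
      IsScalarTower.algebraMap_apply R S C, ← IsScalarTower.algebraMap_apply k R S,
      ← IsScalarTower.algebraMap_apply k S C]
  have : Module.Finite A C := Module.Finite.of_isLocalization R S m.primeCompl
  have : FaithfulSMul A C := (faithfulSMul_iff_algebraMap_injective A C).mpr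
    (IsLocalization.map_injective_of_injective' m.primeCompl S C (N := T)
      m.primeCompl.le_comap_map (fun h0 ↦ zero_notMem_nonZeroDivisors (hT h0))
      (FaithfulSMul.algebraMap_injective R S))
  let ε' : C →ₐ[k] k := IsLocalization.liftAlgHom (M := T) (f := ε) (by
    rintro ⟨_, r, hr, rfl⟩
    refine IsUnit.mk0 _ fun h0 ↦ hr ?_
    rw [hm]
    exact h0)
  have hε' (s : S) : ε' (algebraMap S C s) = ε s := IsLocalization.lift_eq _ s
  obtain ⟨M, _, _, φ₁, φ₂, h1, h2, h3, h4, h5, h6⟩ := exists_two_ringHoms ε' hπ hl hdvd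
    (a := algebraMap S C a) (b := algebraMap S C b) (w := algebraMap S C w)
    (by rw [hε', hε', hε]) (by rwa [hε']) (by
      rw [← IsScalarTower.algebraMap_apply, IsScalarTower.algebraMap_apply R S C, ← map_pow,
        ← map_mul, ← map_mul, h])
  refine ⟨M, inferInstance, inferInstance, φ₁.comp (algebraMap S C), φ₂.comp (algebraMap S C),
    ?_, ?_, h3.comp hSC, h4.comp hSC, ?_, h6⟩
  · rw [RingHom.comp_assoc, RingHom.comp_assoc, ← IsScalarTower.algebraMap_eq,
      IsScalarTower.algebraMap_eq R A C, ← RingHom.comp_assoc, ← RingHom.comp_assoc, h1]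
  · rw [RingHom.comp_assoc, ← IsScalarTower.algebraMap_eq, h2]
  · exact fun h ↦ h5 (IsLocalization.ringHom_ext T h)

open IsLocalRing in
/-- If `l` divides the ramification index at `p = ker ε`, then a uniformizer `r` satisfies
`a r = b t ^ (l n)` with `a, b ∉ p`; multiplying `a` and dividing `r` by a constant gives
`ε a = ε b`. -/
theorem exists_two_ringHoms_of_dvd_ramificationIdx {k R S : Type u} [Field k] [Finite k]
    [CommRing R] [IsDomain R] [CommRing S] [IsDomain S] [IsIntegrallyClosed S] [Algebra k R]
    [Algebra k S] [Algebra R S] [IsScalarTower k R S] [Module.Finite R S]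
    (ε : S →ₐ[k] k) (m : Ideal R) [m.IsPrime] (hm : m = (RingHom.ker ε).comap (algebraMap R S))
    (p : Ideal S) [p.IsPrime] (hp : p = RingHom.ker ε)
    (A B : Type u) [CommRing A] [IsDomain A] [IsDiscreteValuationRing A] [Algebra R A]
    [IsLocalization.AtPrime A m] [CommRing B] [IsDomain B] [IsDiscreteValuationRing B] [Algebra S B]
    [IsLocalization.AtPrime B p] [Algebra A B] [IsLocalHom (algebraMap A B)]
    (hAB : (algebraMap A B).comp (algebraMap R A) = (algebraMap S B).comp (algebraMap R S))
    {l : ℕ} (hl : l.Prime) (hdvd : l ∣ Nat.card k - 1)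
    (hram : l ∣ (maximalIdeal B).ramificationIdx A) :
    ∃ (M : Type u) (_ : Field M) (_ : Algebra k M) (φ₁ φ₂ : S →+* M),
      φ₁.comp (algebraMap R S) = φ₂.comp (algebraMap R S) ∧
      φ₁.comp (algebraMap k S) = algebraMap k M ∧ Function.Injective φ₁ ∧
      Function.Injective φ₂ ∧ φ₁ ≠ φ₂ ∧
      ∀ x : M, IsAlgebraic k x → x ∈ Set.range (algebraMap k M) := by
  have hp0 : p ≠ ⊥ := by
    rintro rfl
    refine IsDiscreteValuationRing.not_a_field B ?_
    rw [← IsLocalization.AtPrime.map_eq_maximalIdeal (⊥ : Ideal S) B, Ideal.map_bot]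
  have : FaithfulSMul R S :=
    faithfulSMul_of_isDiscreteValuationRing_atPrime hp0 m (by rw [hm, hp]) A
  have hSB : Function.Injective (algebraMap S B) :=
    IsLocalization.injective B p.primeCompl_le_nonZeroDivisors
  have : FaithfulSMul A B := by
    rw [faithfulSMul_iff_algebraMap_injective, injective_iff_map_eq_zero]
    intro x hx
    obtain ⟨⟨r, s⟩, hrs⟩ := IsLocalization.surj m.primeCompl x
    have h1 : algebraMap S B (algebraMap R S r) = 0 := by
      rw [← RingHom.comp_apply, ← hAB, RingHom.comp_apply, ← hrs, map_mul, hx, zero_mul]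
    rw [map_eq_zero_iff _ hSB, map_eq_zero_iff _ (FaithfulSMul.algebraMap_injective R S)] at h1
    rw [h1, map_zero] at hrs
    exact (IsLocalization.map_units A s).mul_left_eq_zero.mp hrs
  obtain ⟨π₀, hπ₀⟩ := IsDiscreteValuationRing.exists_irreducible A
  obtain ⟨⟨r, s⟩, hrs⟩ := IsLocalization.surj m.primeCompl π₀
  obtain ⟨t₀, ht₀⟩ := IsDiscreteValuationRing.exists_irreducible B
  obtain ⟨⟨t, s'⟩, hts⟩ := IsLocalization.surj p.primeCompl t₀
  have hr : Irreducible (algebraMap R A r) := by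
    rw [← hrs]
    exact (irreducible_mul_isUnit (IsLocalization.map_units A s)).mpr hπ₀
  have ht : Irreducible (algebraMap S B t) := by
    rw [← hts]
    exact (irreducible_mul_isUnit (IsLocalization.map_units B s')).mpr ht₀
  obtain ⟨v, hv⟩ := associated_algebraMap_pow_ramificationIdx hr ht
  obtain ⟨⟨a, b⟩, hab⟩ := IsLocalization.surj p.primeCompl (v : B)
  have hvb : IsUnit (algebraMap S B a) :=
    hab ▸ v.isUnit.mul (IsLocalization.map_units B b)
  have hεb : ε b ≠ 0 := fun h ↦ b.2 (hp ▸ h)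
  have hεa : ε a ≠ 0 := fun h ↦
    (IsLocalization.AtPrime.isUnit_to_map_iff B p a).mp hvb (hp ▸ h)
  obtain ⟨n, hn⟩ := hram
  have hmain : a * algebraMap R S r = b * (t ^ n) ^ l := by
    refine hSB ?_
    rw [map_mul, map_mul, ← hab, ← RingHom.comp_apply, ← hAB, RingHom.comp_apply, ← pow_mul,
      mul_comm n, ← hn, map_pow, ← hv]
    ring
  let c : k := ε b / ε a
  have hc : c ≠ 0 := div_ne_zero hεb hεa
  have hc' : algebraMap k S c * algebraMap k S c⁻¹ = 1 := by
    rw [← map_mul, mul_inv_cancel₀ hc, map_one]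
  refine exists_two_ringHoms_of_isLocalization ε m hm (A := A) (π := algebraMap k R c⁻¹ * r) ?_ hl
    hdvd (a := b) (b := algebraMap k S c * a) (w := t ^ n) ?_ ?_ ?_
  · rw [map_mul]
    exact (irreducible_isUnit_mul (((IsUnit.mk0 _ (inv_ne_zero hc)).map _).map _)).mpr hr
  · rw [map_mul, ε.commutes]
    exact (div_mul_cancel₀ _ hεa).symm
  · rw [map_mul, ε.commutes]
    exact mul_ne_zero hc hεa
  · rw [map_mul, ← IsScalarTower.algebraMap_apply, ← hmain]
    linear_combination a * algebraMap R S r * hc'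

/-! ### Geometrically irreducible components of fibre products -/

/-- A closed subscheme of a `k`-scheme is geometrically irreducible if it is the closure of the
image of a point `Spec M` with `k` algebraically closed in `M`. After base change to `K`, the fibre
over the point is the image of the spectrum of the domain `M ⊗[k] K`, and it is dense because
`Spec K ⟶ Spec k` is universally open. The scheme structure of the subscheme does not matter. -/
theorem geometricallyIrreducible_subschemeι_comp {k : Type u} [Field k] [PerfectField k]
    {M : Type u} [Field M] [Algebra k M]
    (hM : ∀ x : M, IsAlgebraic k x → x ∈ Set.range (algebraMap k M)) {W : Scheme.{u}}
    (πW : W ⟶ Spec (.of k)) (ψ : Spec (.of M) ⟶ W)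
    (hψ : ψ ≫ πW = Spec.map (CommRingCat.ofHom (algebraMap k M)))
    (I : W.IdealSheafData) (hI : (I.support : Set W) = closure {ψ (IsLocalRing.closedPoint M)}) :
    GeometricallyIrreducible (I.subschemeι ≫ πW) := by
  rw [geometricallyIrreducible_iff, geometrically_iff_of_commRing]
  intro K _ _ Z fst snd hZ
  let g : Spec (.of K) ⟶ Spec (.of k) := Spec.map (CommRingCat.ofHom (algebraMap k K))
  let WK := pullback πW g
  have hWK : IsPullback (pullback.fst πW g) (pullback.snd πW g) πW g := .of_hasPullback _ _
  let ι : Z ⟶ WK := pullback.lift (fst ≫ I.subschemeι) snd (by rw [Category.assoc, hZ.w])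
  have hι : IsPullback ι fst (pullback.fst πW g) I.subschemeι := by
    refine IsPullback.of_right (h₁₁ := ι) (h₁₂ := pullback.snd πW g) ?_ ?_ hWK.flip
    · rw [pullback.lift_snd]
      exact hZ.flip
    · rw [pullback.lift_fst]
  have hopen : IsOpenMap (pullback.fst πW g) := (pullback.fst πW g).isOpenMap
  let T := pullback ψ (pullback.fst πW g)
  have hT : IsPullback (pullback.fst ψ (pullback.fst πW g))
      (pullback.snd ψ (pullback.fst πW g) ≫ pullback.snd πW g)
      (Spec.map (CommRingCat.ofHom (algebraMap k M))) g := by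
    rw [← hψ]
    exact (IsPullback.paste_horiz (IsPullback.of_hasPullback ψ (pullback.fst πW g)).flip
      hWK.flip).flip
  have : IsDomain (M ⊗[k] K) := isDomain_tensorProduct_of_forall_isAlgebraic hM K
  have : IrreducibleSpace T :=
    ((hT.isoPullback ≪≫ pullbackSpecIso k M K).hom.homeomorph.irreducibleSpace_iff).mpr
      (inferInstanceAs (IrreducibleSpace (PrimeSpectrum (M ⊗[k] K))))
  have hirr : IsIrreducible ((pullback.fst πW g) ⁻¹' {ψ (IsLocalRing.closedPoint M)}) := by
    have h1 : Set.range ψ = {ψ (IsLocalRing.closedPoint M)} := by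
      refine Set.eq_singleton_iff_unique_mem.mpr ⟨⟨_, rfl⟩, ?_⟩
      rintro _ ⟨x, rfl⟩
      exact congrArg ψ (Subsingleton.elim _ _)
    rw [← h1, ← Scheme.Pullback.range_snd, ← Set.image_univ]
    exact (IrreducibleSpace.isIrreducible_univ T).image _
      (pullback.snd ψ (pullback.fst πW g)).continuous.continuousOn
  have hrange : Set.range ι = closure ((pullback.fst πW g) ⁻¹' {ψ (IsLocalRing.closedPoint M)}) := by
    rw [← hopen.preimage_closure_eq_closure_preimage (pullback.fst πW g).continuous, ← hI,
      ← I.range_subschemeι]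
    have h1 := Scheme.image_preimage_eq_of_isPullback hι.flip Set.univ
    rw [Set.preimage_univ, Set.image_univ, Set.image_univ] at h1
    exact h1
  have : IsClosedImmersion ι := MorphismProperty.of_isPullback hι.flip inferInstance
  have : IrreducibleSpace (Set.range ι) := Subtype.irreducibleSpace (hrange ▸ hirr.closure)
  exact (ι.isEmbedding.toHomeomorph.irreducibleSpace_iff).mpr this

/-- A point of a sober space without proper generalizations is the generic point of an irreducible
component. -/
theorem closure_singleton_mem_irreducibleComponents {W : Type*} [TopologicalSpace W] [QuasiSober W]
    {z : W} (hz : ∀ w : W, w ⤳ z → z ⤳ w) : closure {z} ∈ irreducibleComponents W := by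
  refine ⟨isIrreducible_singleton.closure, fun s hs hzs ↦ ?_⟩
  have h1 : hs.genericPoint ⤳ z := by
    rw [specializes_iff_mem_closure, hs.genericPoint_closure_eq]
    exact subset_closure (hzs (subset_closure rfl))
  have h2 := hz _ h1
  intro w hw
  have h3 : hs.genericPoint ⤳ w := by
    rw [specializes_iff_mem_closure, hs.genericPoint_closure_eq]
    exact subset_closure hw
  exact specializes_iff_mem_closure.mp (h2.trans h3)

/-- A generalization of `z` lies over the generic point as well, and fibres of `f` are
discrete. -/
theorem closure_singleton_mem_irreducibleComponents_of_isFinite {W X : Scheme.{u}}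
    [IrreducibleSpace X] (f : W ⟶ X) [IsFinite f] {z : W} (hz : f z = genericPoint X) :
    closure {z} ∈ irreducibleComponents W := by
  refine closure_singleton_mem_irreducibleComponents fun w hw ↦ ?_
  have h1 : f w = f z := by
    refine ((hw.map f.continuous).antisymm ?_).eq
    rw [hz]
    exact genericPoint_specializes _
  exact ((f.isDiscrete_preimage_singleton (f z)).eq_of_specializes hw h1 rfl).symm ▸ specializes_rfl

/-- A morphism from a reduced scheme factors through the diagonal if it does so on points. -/
theorem comp_fst_eq_comp_snd_of_mem_range_diagonal {X Y T : Scheme.{u}} (f : X ⟶ Y) [IsSeparated f]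
    [IsReduced T] (ψ : T ⟶ pullback f f)
    (h : Set.range ψ ⊆ Set.range (pullback.diagonal f)) :
    ψ ≫ pullback.fst f f = ψ ≫ pullback.snd f f := by
  let p := pullback.fst ψ (pullback.diagonal f)
  have : Surjective p := ⟨by
    rw [← Set.range_eq_univ, Scheme.Pullback.range_fst, Set.eq_univ_iff_forall]
    exact fun t ↦ h ⟨t, rfl⟩⟩
  have : IsIso p := isIso_of_isClosedImmersion_of_surjective p
  rw [← cancel_epi p]
  simp [p, pullback.condition_assoc]

/-! ### Local rings of curves -/

attribute [local instance] specializationOrder in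
theorem ringKrullDim_stalk_le_topologicalKrullDim (X : Scheme.{u}) (x : X) :
    ringKrullDim (X.presheaf.stalk x) ≤ topologicalKrullDim X := by
  rw [ringKrullDim_stalk_eq_coheight, topologicalKrullDim,
    Order.krullDim_eq_of_orderIso (irreducibleSetEquivPoints (α := X))]
  exact Order.coheight_le_krullDim x

theorem isPrincipalIdealRing_of_isRegularLocalRing {R : Type*} [CommRing R] [IsDomain R]
    [IsRegularLocalRing R] (h : ringKrullDim R ≤ 1) : IsPrincipalIdealRing R := by
  have h1 : (IsLocalRing.maximalIdeal R).spanFinrank ≤ 1 := by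
    rw [← IsRegularLocalRing.spanFinrank_maximalIdeal] at h
    exact_mod_cast h
  refine ((tfae_of_isNoetherianRing_of_isLocalRing_of_isDomain R).out 4 0).mp ?_
  obtain h2 | h2 := Nat.le_one_iff_eq_zero_or_eq_one.mp h1
  · rw [(Submodule.spanFinrank_eq_zero_iff_eq_bot (IsNoetherian.noetherian _)).mp h2]
    infer_instance
  · exact ((Submodule.spanFinrank_eq_one_iff _).mp h2).1

/-- The local ring is not a field, for otherwise `x` would be the generic point, hence the only
point, of `X`. -/
theorem isDiscreteValuationRing_stalk_of_isClosed {X : Scheme.{u}} [IsIntegral X]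
    (hdim : topologicalKrullDim X = 1) (x : X) [IsRegularLocalRing (X.presheaf.stalk x)]
    (hx : IsClosed {x}) : IsDiscreteValuationRing (X.presheaf.stalk x) := by
  have hpir : IsPrincipalIdealRing (X.presheaf.stalk x) :=
    isPrincipalIdealRing_of_isRegularLocalRing
      ((ringKrullDim_stalk_le_topologicalKrullDim X x).trans hdim.le)
  have hnf : ¬ IsField (X.presheaf.stalk x) := by
    intro hf
    have h1 := ringKrullDim_eq_zero_of_isField hf
    rw [ringKrullDim_stalk_eq_coheight] at h1
    have h2 : IsMax x := Order.coheight_eq_zero.mp (by exact_mod_cast h1)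
    have h3 : x = genericPoint X :=
      ((genericPoint_specializes x).antisymm (h2 (genericPoint_specializes x))).eq.symm
    have h4 : ({x} : Set X) = Set.univ := by
      rw [← hx.closure_eq, h3]
      exact genericPoint_spec X
    have : Subsingleton X := Set.subsingleton_univ_iff.mp (h4 ▸ Set.subsingleton_singleton)
    have h5 := topologicalKrullDim_zero_of_discreteTopology X
    rw [hdim] at h5
    exact absurd h5 (by decide)
  exact { hpir with not_a_field' := IsLocalRing.isField_iff_maximalIdeal_eq.not.mp hnf }

theorem isIntegrallyClosed_of_isAffineOpen {X : Scheme.{u}} [IsIntegral X] {U : X.Opens}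
    [Nonempty U] (hU : IsAffineOpen U) (h : ∀ x : X, IsIntegrallyClosed (X.presheaf.stalk x)) :
    IsIntegrallyClosed Γ(X, U) := by
  refine IsIntegrallyClosed.of_localization_maximal fun p _ _ ↦ ?_
  let y : PrimeSpectrum Γ(X, U) := ⟨p, inferInstance⟩
  let x : U := ⟨hU.fromSpec y, (hU.isoSpec.inv y).2⟩
  have hxy : (hU.primeIdealOf x).asIdeal = p := by
    have : hU.primeIdealOf x = y := hU.fromSpec.injective (hU.fromSpec_primeIdealOf x)
    rw [this]
  let : Algebra Γ(X, U) (X.presheaf.stalk (x : X)) :=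
    TopCat.Presheaf.algebra_section_stalk X.presheaf x
  have h1 := hU.isLocalization_stalk x
  simp only [hxy] at h1
  have := h (x : X)
  exact .of_equiv (IsLocalization.algEquiv p.primeCompl (X.presheaf.stalk (x : X))
    (Localization.AtPrime p)).toRingEquiv

theorem isClosed_singleton_of_comp_eq_id {X S : Scheme.{u}} [Subsingleton S] (P : S ⟶ X)
    (π : X ⟶ S) (h : P ≫ π = 𝟙 S) (o : S) : IsClosed {P o} := by
  have := isClosedImmersion_of_comp_eq_id π P h
  rw [← Set.image_singleton]
  exact P.isClosedEmbedding.isClosedMap _ ((Set.subsingleton_of_subsingleton).isClosed)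

theorem mem_ideal_iff_eq_zero_of_ringEquiv {R K : Type*} [CommRing R] [Field K] (e : R ≃+* K)
    (I : Ideal R) [I.IsPrime] (r : R) : r ∈ I ↔ e r = 0 := by
  refine ⟨fun hr ↦ ?_, fun hr ↦ ?_⟩
  · by_contra h0
    exact (inferInstance : I.IsPrime).ne_top
      (I.eq_top_of_isUnit_mem hr ((MulEquiv.isUnit_map e).mp (IsUnit.mk0 _ h0)))
  · rw [(map_eq_zero_iff e e.injective).mp hr]
    exact zero_mem I

theorem appLE_comp_appLE_of_comp_eq {X Y Z : Scheme.{u}} {f : X ⟶ Y} {g : Y ⟶ Z} {h : X ⟶ Z}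
    (hfg : f ≫ g = h) {U : X.Opens} {V : Y.Opens} {W : Z.Opens} (hVW : V ≤ g ⁻¹ᵁ W)
    (hUV : U ≤ f ⁻¹ᵁ V) (hUW : U ≤ h ⁻¹ᵁ W) :
    g.appLE W V hVW ≫ f.appLE V U hUV = h.appLE W U hUW := by
  subst hfg
  exact Scheme.Hom.appLE_comp_appLE ..

/-- The geometric form of `exists_two_ringHoms_of_dvd_ramificationIdx`: two points of `X` with
values in a field `M` in which `k` is algebraically closed, lying over the generic point of `X` and
over the same point of `Y`. -/
theorem exists_two_points {k : Type u} [Field k] [Finite k] {X Y : Scheme.{u}}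
    {πX : X ⟶ Spec (.of k)} {πY : Y ⟶ Spec (.of k)} (hX : IsCurve πX) (hY : IsCurve πY)
    (f : X ⟶ Y) (hf : f ≫ πY = πX) [IsFinite f] [IsIntegral X] [IsIntegral Y]
    (P : Spec (.of k) ⟶ X) (hP : P ≫ πX = 𝟙 (Spec (.of k))) {l : ℕ} (hl : l.Prime)
    (hdvd : l ∣ Nat.card k - 1)
    (hram : l ∣ ramificationIndex f (P (IsLocalRing.closedPoint k))) :
    ∃ (M : Type u) (_ : Field M) (_ : Algebra k M) (g₁ g₂ : Spec (.of M) ⟶ X),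
      g₁ ≫ f = g₂ ≫ f ∧ g₁ ≫ πX = Spec.map (CommRingCat.ofHom (algebraMap k M)) ∧
      g₁ (IsLocalRing.closedPoint M) = genericPoint X ∧ g₁ ≠ g₂ ∧
      ∀ x : M, IsAlgebraic k x → x ∈ Set.range (algebraMap k M) := by
  let o : Spec (.of k) := IsLocalRing.closedPoint k
  let x : X := P o
  obtain ⟨V, hV, hxV, -⟩ := exists_isAffineOpen_mem_and_subset (x := f x) (U := ⊤) trivial
  let U := f ⁻¹ᵁ V
  have hU : IsAffineOpen U := hV.preimage f
  have hxU : x ∈ U := hxV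
  have : Nonempty U := ⟨⟨x, hxU⟩⟩
  have : Nonempty V := ⟨⟨f x, hxV⟩⟩
  have hxcl : IsClosed {x} := isClosed_singleton_of_comp_eq_id P πX hP o
  have hfxcl : IsClosed {f x} := isClosed_singleton_of_comp_eq_id (P ≫ f) πY
    (by rw [Category.assoc, hf, hP]) o
  have := hX.nonsingular
  have := hY.nonsingular
  have := isDiscreteValuationRing_stalk_of_isClosed hX.dimension x hxcl
  have := isDiscreteValuationRing_stalk_of_isClosed hY.dimension (f x) hfxcl
  have : IsIntegrallyClosed Γ(X, U) := isIntegrallyClosed_of_isAffineOpen hU fun x ↦ by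
    have : IsPrincipalIdealRing (X.presheaf.stalk x) :=
      isPrincipalIdealRing_of_isRegularLocalRing
        ((ringKrullDim_stalk_le_topologicalKrullDim X x).trans hX.dimension.le)
    infer_instance
  let : Algebra Γ(Y, V) Γ(X, U) := (f.app V).hom.toAlgebra
  have : Module.Finite Γ(Y, V) Γ(X, U) := f.finite_app V hV
  have hVY : V ≤ πY ⁻¹ᵁ ⊤ := le_top
  have hUX : U ≤ πX ⁻¹ᵁ ⊤ := le_top
  -- The `k`-algebra structures given by `πX` and `πY`, and the evaluation `e` at `P`.
  let iY : CommRingCat.of k ⟶ Γ(Y, V) := (Scheme.ΓSpecIso (.of k)).inv ≫ πY.appLE ⊤ V hVY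
  let iX : CommRingCat.of k ⟶ Γ(X, U) := (Scheme.ΓSpecIso (.of k)).inv ≫ πX.appLE ⊤ U hUX
  have hi : iY ≫ f.app V = iX := by
    rw [f.app_eq_appLE, Category.assoc, appLE_comp_appLE_of_comp_eq hf]
  let : Algebra k Γ(Y, V) := iY.hom.toAlgebra
  let : Algebra k Γ(X, U) := iX.hom.toAlgebra
  have : IsScalarTower k Γ(Y, V) Γ(X, U) := .of_algebraMap_eq' (congrArg CommRingCat.Hom.hom hi).symm
  have hPU : ⊤ ≤ P ⁻¹ᵁ U := fun t _ ↦ Subsingleton.elim o t ▸ hxU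
  let e : Γ(X, U) ⟶ CommRingCat.of k := P.appLE U ⊤ hPU ≫ (Scheme.ΓSpecIso (.of k)).hom
  have he : iX ≫ e = 𝟙 _ := by
    have h0 : (⊤ : (Spec (.of k)).Opens) ≤ (𝟙 (Spec (.of k))) ⁻¹ᵁ ⊤ := le_rfl
    have h := appLE_comp_appLE_of_comp_eq hP hUX hPU h0
    have h1 : (𝟙 (Spec (.of k)) : Spec (.of k) ⟶ _).appLE ⊤ ⊤ h0 = 𝟙 _ :=
      ((𝟙 (Spec (.of k)) : Spec (.of k) ⟶ _).app_eq_appLE (U := ⊤)).symm.trans (Scheme.Hom.id_app ⊤)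
    rw [Category.assoc, reassoc_of% h, h1, Category.id_comp, Iso.inv_hom_id]
  let ε : Γ(X, U) →ₐ[k] k := ⟨e.hom, fun c ↦ ConcreteCategory.congr_hom he c⟩
  let : Algebra (Y.presheaf.stalk (f x)) (X.presheaf.stalk x) := (f.stalkMap x).hom.toAlgebra
  let : Algebra Γ(Y, V) (Y.presheaf.stalk (f x)) :=
    TopCat.Presheaf.algebra_section_stalk Y.presheaf ⟨f x, hxV⟩
  let : Algebra Γ(X, U) (X.presheaf.stalk x) :=
    TopCat.Presheaf.algebra_section_stalk X.presheaf ⟨x, hxU⟩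
  let m := (hV.primeIdealOf ⟨f x, hxV⟩).asIdeal
  let p := (hU.primeIdealOf ⟨x, hxU⟩).asIdeal
  have : IsLocalization.AtPrime (Y.presheaf.stalk (f x)) m := hV.isLocalization_stalk ⟨f x, hxV⟩
  have : IsLocalization.AtPrime (X.presheaf.stalk x) p := hU.isLocalization_stalk ⟨x, hxU⟩
  have hmp : m = p.comap (algebraMap Γ(Y, V) Γ(X, U)) := by
    have h := IsAffineOpen.comap_primeIdealOf_appLE V hV U hU le_rfl hxU
    rw [← f.app_eq_appLE] at h
    exact congrArg PrimeSpectrum.asIdeal h.symm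
  have hp : p = RingHom.ker ε := by
    have h := IsAffineOpen.comap_primeIdealOf_appLE (x := o) U hU ⊤ (isAffineOpen_top _) hPU trivial
    ext c
    rw [show p = _ from congrArg PrimeSpectrum.asIdeal h.symm]
    exact mem_ideal_iff_eq_zero_of_ringEquiv
      (Scheme.ΓSpecIso (.of k)).commRingCatIsoToRingEquiv
      ((isAffineOpen_top _).primeIdealOf ⟨o, trivial⟩).asIdeal (P.appLE U ⊤ hPU c)
  have : IsLocalHom (algebraMap (Y.presheaf.stalk (f x)) (X.presheaf.stalk x)) :=
    inferInstanceAs (IsLocalHom (f.stalkMap x).hom)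
  obtain ⟨M, _, _, φ₁, φ₂, h1, h2, h3, -, h5, h6⟩ :=
    exists_two_ringHoms_of_dvd_ramificationIdx ε m (by rw [hmp, hp]) p hp
      (Y.presheaf.stalk (f x)) (X.presheaf.stalk x)
      (congrArg CommRingCat.Hom.hom (f.germ_stalkMap V x hxV)) hl hdvd hram
  refine ⟨M, inferInstance, inferInstance, Spec.map (CommRingCat.ofHom φ₁) ≫ hU.fromSpec,
    Spec.map (CommRingCat.ofHom φ₂) ≫ hU.fromSpec, ?_, ?_, ?_, ?_, h6⟩
  · have h7 : f.app V ≫ CommRingCat.ofHom φ₁ = f.app V ≫ CommRingCat.ofHom φ₂ :=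
      CommRingCat.hom_ext h1
    have h8 := IsAffineOpen.SpecMap_appLE_fromSpec f hV hU le_rfl
    rw [Category.assoc, Category.assoc, ← h8, ← f.app_eq_appLE, ← Spec.map_comp_assoc,
      ← Spec.map_comp_assoc, h7]
  · have h8 := IsAffineOpen.SpecMap_appLE_fromSpec πX (isAffineOpen_top _) hU hUX
    rw [Category.assoc, ← h8, IsAffineOpen.fromSpec_top, Scheme.isoSpec_Spec_inv, ← Spec.map_comp,
      ← Spec.map_comp]
    congr 1
    exact CommRingCat.hom_ext h2
  · rw [← genericPoint_eq_of_isOpenImmersion hU.fromSpec]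
    refine congrArg hU.fromSpec ?_
    rw [genericPoint_eq_bot_of_affine]
    refine PrimeSpectrum.ext ?_
    change Ideal.comap φ₁ (IsLocalRing.maximalIdeal M) = ⊥
    rw [IsLocalRing.maximalIdeal_eq_bot, Ideal.comap_bot_of_injective φ₁ h3]
  · rw [Ne, cancel_mono, Spec.map_inj]
    exact fun h ↦ h5 (congrArg CommRingCat.Hom.hom h)

end CurveCover

theorem theorem1p2 {k : Type u} [Field k] [Finite k] {X Y : Scheme.{u}}
    (πX : X ⟶ Spec (.of k)) (πY : Y ⟶ Spec (.of k))
    (hX : CurveCover.IsCurve πX) (hY : CurveCover.IsCurve πY)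
    (f : X ⟶ Y) (hf : f ≫ πY = πX) (hfin : IsFinite f)
    (hexc : CurveCover.IsExceptionalCover πX f)
    (P : Spec (.of k) ⟶ X) (hP : P ≫ πX = 𝟙 (Spec (.of k))) :
    Nat.Coprime (CurveCover.ramificationIndex f (P (IsLocalRing.closedPoint k)))
      (Nat.card k - 1) := by
  have := hX.geometricallyIntegral
  have := hY.geometricallyIntegral
  have : IsIntegral X := GeometricallyIntegral.isIntegral_of_subsingleton πX
  have : IsIntegral Y := GeometricallyIntegral.isIntegral_of_subsingleton πY
  refine Nat.Coprime.symm (Nat.coprime_of_dvd fun l hl hdvd hram ↦ ?_)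
  obtain ⟨M, _, _, g₁, g₂, hg, hgk, hgen, hne, hM⟩ :=
    CurveCover.exists_two_points hX hY f hf P hP hl hdvd hram
  let ψ : Spec (.of M) ⟶ pullback f f := pullback.lift g₁ g₂ hg
  let z := ψ (IsLocalRing.closedPoint M)
  have hz : pullback.fst f f z = genericPoint X := by
    rw [← hgen]
    exact congr($(pullback.lift_fst g₁ g₂ hg) (IsLocalRing.closedPoint M))
  have hcomp := CurveCover.closure_singleton_mem_irreducibleComponents_of_isFinite _ hz
  have hmem : closure {z} ∈ {Z : Set ↥(pullback f f) |
      CurveCover.IsGeometricallyIrreducibleComponent (pullback.fst f f ≫ πX) Z} :=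
    ⟨hcomp, CurveCover.geometricallyIrreducible_subschemeι_comp hM _ ψ
      (by rw [pullback.lift_fst_assoc, hgk]) _
      (Scheme.IdealSheafData.coe_support_vanishingIdeal _)⟩
  rw [hexc, Set.mem_singleton_iff] at hmem
  refine hne ?_
  have h := CurveCover.comp_fst_eq_comp_snd_of_mem_range_diagonal f ψ (by
    rintro _ ⟨t, rfl⟩
    rw [← hmem, Subsingleton.elim t (IsLocalRing.closedPoint M)]
    exact subset_closure rfl)
  rwa [pullback.lift_fst, pullback.lift_snd] at h
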